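/- Let $S$ be a countable set and $n\ge 0$ an integer. Let $\mathbb M_\ell$ be the Banach space of real matrices $M=(m_{ij})_{i,j\in S}$ with $\|M\|_\ell:=\sup_{i}\sum_{j}|m_{ij}|<\infty$. For a bounded family $f$ indexed by $S$ put $\|f\|_\infty:=\sup_{i\in S}\|f(i)\|$, and let $\|\nu-\nu'\|_{\rm var}:=\sum_j|\nu_j-\nu'_j|$. Derivatives $\partial_x,\nabla$ and $\partial_x^2,\nabla^2$ in $x\in\mathbb R^n$ (with the Euclidean norm) are measured by the norms of the corresponding linear and bilinear maps; for $\nabla Q,\nabla^2Q$ these maps take values in $(\mathbb M_\ell,\|\cdot\|_\ell)$, and the norms are written $\|\nabla Q(x)\|_\ell$, $\|\nabla^2Q(x)\|_\ell$. Let $Q:\mathbb R^n\to\mathbb M_\ell$, $Q(x)=(q_{ij}(x))$, have measurable entries and satisfy, for every $x$: (i) $q_{ij}(x)\ge 0$ for $i\ne j$ and $\sum_jq_{ij}(x)=0$ for all $i$; (ii) the equations $\mu^xQ(x)=0$, $\sum_i\mu^x_i=1$ have a unique solution $\mu^x$, and $\mu^x_i>0$ for all $i$; (iii) the transition function $P^x_t=(p^x_{ij}(t))$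 of $Q(x)$ satisfies $\sup_{i\in S,\,x\in\mathbb R^n}\|p^x_{i\cdot}(t)-\mu^x\|_{\rm var}\le C_0e^{-\lambda t}$ for all $t>0$, where $C_0,\lambda>0$ are constants. Let $F:\mathbb R^n\times S\to\mathbb R^n$ satisfy $\|F(x,\cdot)\|_\infty<\infty$ and $\sum_iF(x,i)\mu^x_i=0$ for all $x$. Let $(\alpha^{x,i}_t)_{t\ge0}$ be the $S$-valued Markov chain generated by $Q(x)$ with $\alpha^{x,i}_0=i$, and put $$\Phi(x,i)=\int_0^\infty\mathbb E\,F(x,\alpha^{x,i}_t)\,dt .$$ Then there is a constant $C>0$, depending only on $n,S,C_0,\lambda$, such that the following hold. (a) The integral defining $\Phi(x,i)$ converges absolutely (that is, $\int_0^\infty|\mathbb E F(x,\alpha^{x,i}_t)|\,dt<\infty$), $-Q(x)\Phi(x,\cdot)(i)=F(x,i)$ for all $x,i$, and for all $x$ $$\|\Phi(x,\cdot)\|_\infty\le C\|F(x,\cdot)\|_\infty .$$ For $k\in\{1,2\}$ write $F\in C^k(\mathbb R^n\times S)$ if $F(\cdot,i)$ is $C^k$ for each $i\in S$ and $x\mapsto\|\partial_x^jF(x,\cdot)\|_\infty$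 is finite and locally bounded for $j=0,\dots,k$. (b) If $Q\in C^1(\mathbb R^n,\mathbb M_\ell)$ and $F\in C^1(\mathbb R^n\times S)$, then $\Phi(\cdot,i)$ is $C^1$ for each $i$, and for all $x$ $$\|\partial_x\Phi(x,\cdot)\|_\infty\le C\big[\|F(x,\cdot)\|_\infty\|\nabla Q(x)\|_\ell+\|\partial_xF(x,\cdot)\|_\infty\big].$$ (c) If $Q\in C^2(\mathbb R^n,\mathbb M_\ell)$ and $F\in C^2(\mathbb R^n\times S)$, then $\Phi(\cdot,i)$ is $C^2$ for each $i$, and for all $x$ $$\|\partial_x^2\Phi(x,\cdot)\|_\infty\le C\big[\|F(x,\cdot)\|_\infty\big(\|\nabla Q(x)\|_\ell+\|\nabla Q(x)\|_\ell^2+\|\nabla^2Q(x)\|_\ell\big)+\|\partial_xF(x,\cdot)\|_\infty\|\nabla Q(x)\|_\ell+\|\partial_x^2F(x,\cdot)\|_\infty\big].$$ -/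

import Mathlib

open scoped ENNReal Topology

noncomputable section

/-- Matrices `M = (m_{ij})` indexed by `S × S` with `‖M‖_ℓ = sup_i ∑_j |m_{ij}| < ∞`, as the Banach
space of bounded families (indexed by the rows) of absolutely summable sequences; its norm is
`‖·‖_ℓ`, see `RowMatrix.norm_eq`. For finite `S` these are all the matrices. -/
abbrev RowMatrix (S : Type*) : Type _ :=
  lp (fun _ : S => lp (fun _ : S => ℝ) (1 : ℝ≥0∞)) (⊤ : ℝ≥0∞)

/-- The entry `m_{ij}`. -/
def RowMatrix.entry {S : Type*} (M : RowMatrix S) (i j : S) : ℝ := (M i : S → ℝ) j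

theorem RowMatrix.norm_eq {S : Type*} (M : RowMatrix S) :
    ‖M‖ = ⨆ i, ∑' j, |M.entry i j| := by
  rw [lp.norm_eq_ciSup]
  refine iSup_congr fun i => ?_
  rw [lp.norm_eq_tsum_rpow (by simp)]
  simp [RowMatrix.entry]

/-- `‖f‖_∞ = sup_{i ∈ S} ‖f i‖` (used for bounded families `f` only). -/
def supNorm {S E : Type*} [Norm E] (f : S → E) : ℝ := ⨆ i, ‖f i‖

/-- `‖ν - ν'‖_var = ∑_j |ν_j - ν'_j|`. -/
def varDist {S : Type*} (ν ν' : S → ℝ) : ℝ := ∑' j, |ν j - ν' j|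

/-- `Q` is a conservative `Q`-matrix. -/
structure IsConservative {S : Type*} (Q : RowMatrix S) : Prop where
  offDiag_nonneg : ∀ i j, i ≠ j → 0 ≤ Q.entry i j
  row_sum : ∀ i, HasSum (fun j => Q.entry i j) 0

/-- `ν Q = 0` and `∑_i ν_i = 1`. -/
structure SolvesInvariance {S : Type*} (Q : RowMatrix S) (ν : S → ℝ) : Prop where
  sum_one : HasSum ν 1
  mul_eq_zero : ∀ j, HasSum (fun i => ν i * Q.entry i j) 0

/-- `Q` is irreducible with invariant law `μ`: the equations `ν Q = 0`, `∑_i ν_i = 1` have `μ` as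
their unique solution, and all `μ_i` are positive. -/
structure IsIrreducibleWith {S : Type*} (Q : RowMatrix S) (μ : S → ℝ) : Prop where
  solves : SolvesInvariance Q μ
  pos : ∀ i, 0 < μ i
  unique : ∀ ν, SolvesInvariance Q ν → ν = μ

open Classical in
/-- `p = (p_{ij}(t))_{t ≥ 0}` is the transition function of `Q`: a semigroup of stochastic matrices
with `p(0)` the identity and `p_{ij}'(0) = q_{ij}`. -/
structure IsTransitionFunction {S : Type*} (Q : RowMatrix S) (p : ℝ → S → S → ℝ) : Prop where
  nonneg : ∀ t, 0 ≤ t → ∀ i j, 0 ≤ p t i j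
  row_sum : ∀ t, 0 ≤ t → ∀ i, HasSum (fun j => p t i j) 1
  zero : ∀ i j, p 0 i j = if i = j then 1 else 0
  chapman_kolmogorov : ∀ s t, 0 ≤ s → 0 ≤ t → ∀ i j,
    HasSum (fun k => p s i k * p t k j) (p (s + t) i j)
  deriv_zero : ∀ i j, HasDerivWithinAt (fun t => p t i j) (Q.entry i j) (Set.Ici 0) 0

/-- The family `Q(x)` is measurable and conservative, `Q(x)` is irreducible with invariant law
`μ^x`, and its transition function `p^x` is exponentially ergodic uniformly in `x`, with constants
`C₀` and `r`. -/
structure IsUniformlyErgodic {X S : Type*} [MeasurableSpace X] (Q : X → RowMatrix S)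
    (μ : X → S → ℝ) (p : X → ℝ → S → S → ℝ) (C₀ r : ℝ) : Prop where
  measurable : ∀ i j, Measurable fun x => (Q x).entry i j
  conservative : ∀ x, IsConservative (Q x)
  irreducible : ∀ x, IsIrreducibleWith (Q x) (μ x)
  transition : ∀ x, IsTransitionFunction (Q x) (p x)
  ergodic : ∀ x i t, 0 < t → varDist (p x t i) (μ x) ≤ C₀ * Real.exp (-r * t)

open MeasureTheory in
/-- Under the probability measure `P`, the process `(α_t)_{t ≥ 0}` is a Markov chain on `S` with
transition function `p` and initial value `i`: for `0 = t_0 ≤ t_1 ≤ … ≤ t_m` and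
`j_0 = i, j_1, …, j_m`,
`P(α_{t_0} = j_0, …, α_{t_m} = j_m) = ∏_{k < m} p_{j_k j_{k+1}}(t_{k+1} - t_k)`. -/
structure IsMarkovChain {Ω S : Type*} [MeasurableSpace Ω] [MeasurableSpace S]
    (P : Measure Ω) (p : ℝ → S → S → ℝ) (i : S) (α : ℝ → Ω → S) : Prop where
  prob : IsProbabilityMeasure P
  measurable : ∀ t, 0 ≤ t → Measurable (α t)
  finiteDim : ∀ (m : ℕ) (t : ℕ → ℝ) (j : ℕ → S), Monotone t → t 0 = 0 → j 0 = i →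
    P {ω | ∀ k ≤ m, α (t k) ω = j k} =
      ENNReal.ofReal (∏ k ∈ Finset.range m, p (t (k + 1) - t k) (j k) (j (k + 1)))

/-- The class `C^k(ℝⁿ × S, E)`: every `F(·, i)` is `C^k`, and for `l ≤ k` the function
`x ↦ ‖∂^l_x F(x, ·)‖_∞` is finite and locally bounded. -/
structure IsCkFamily {X S E : Type*} [NormedAddCommGroup X] [NormedSpace ℝ X]
    [NormedAddCommGroup E] [NormedSpace ℝ E] (k : ℕ) (F : X → S → E) : Prop where
  contDiff : ∀ i, ContDiff ℝ k fun x => F x i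
  locally_bounded : ∀ l ≤ k, ∀ x, ∃ B : ℝ, ∀ᶠ y in 𝓝 x, ∀ i,
    ‖iteratedFDeriv ℝ l (fun z => F z i) y‖ ≤ B

open MeasureTheory in
/-- `Φ(x, i) = ∫₀^∞ 𝔼 F(x, α^{x,i}_t) dt`. -/
def poissonSolution {X S E Ω : Type*} [MeasurableSpace Ω] [NormedAddCommGroup E] [NormedSpace ℝ E]
    (P : X → S → Measure Ω) (α : X → S → ℝ → Ω → S) (F : X → S → E) (x : X) (i : S) : E :=
  ∫ t in Set.Ioi (0 : ℝ), ∫ ω, F x (α x i t ω) ∂(P x i)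

end

/-! Let `Q(x)` act on row vectors. On `ℓ¹(S)` this is a bounded operator of norm at most `‖Q(x)‖_ℓ`,
and the transition function becomes a contraction semigroup `U_t` whose generator, in operator norm,
is `Q(x)`. Let `Π ν = (∑ ν_j) μ^x`. Ergodicity says `‖U_t - Π‖ ≤ C₀ e^{-rt}`, so the deviation
operator `D = ∫₀^∞ (U_t - Π) dt` exists with norm at most `C₀ / r`. Since `F(x, ·)` is centred,
`Φ(x, i)` is the pairing of the `i`-th row of `D(x)` with `F(x, ·)`. Integrating `U_t' = Q U_t`
gives `Q D = D Q = Π - 1`, which is the Poisson equation.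

For regularity in `x`, neither `U_t` nor the integral is differentiated. Fix a state and let `E ν =
(∑ ν_j) δ` with `δ` its unit mass. By `bordered_inverse`, `E - Q(x)` is invertible, its inverse is
`R = D (1 - E) + Π`, and `D = R (1 - R E)`. Here `‖R‖ ≤ K = 2 C₀ / r + 1` uniformly in `x`, and `E`
is constant, so `R` inverts an affine function of `Q(x)`. Hence `R` and `D` are as smooth as `Q`,
and their derivatives are bounded through `K` and those of `Q` (`norm_iteratedFDeriv_inverse_le`).

The remaining difficulty is that `F` is smooth only entrywise, with locally bounded derivatives, so
`x ↦ F(x, ·)` need not be `C^k` into `ℓ^∞`. Pairing with an `ℓ¹`-valued map that is differentiable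
in norm repairs this: `IsFamilyDeriv.hasFDerivAt_pairing` is a Leibniz rule under exactly these
assumptions, and it yields both derivative estimates. -/

noncomputable section

/-! ### Row vectors in `ℓ¹(S)`, their pairing with bounded families, and the action of matrices. -/

namespace RowMatrix

variable {S E : Type*} [NormedAddCommGroup E]

/-- The space `ℓ¹(S)` of absolutely summable sequences, i.e. the rows of a `RowMatrix`. -/
abbrev L1 (S : Type*) : Type _ := lp (fun _ : S => ℝ) (1 : ℝ≥0∞)

/-- The space `ℓ^∞(S, E)` of bounded families. -/
abbrev LInf (S E : Type*) [NormedAddCommGroup E] : Type _ := lp (fun _ : S => E) (⊤ : ℝ≥0∞)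

theorem hasSum_norm_L1 (ν : L1 S) : HasSum (fun j => |ν j|) ‖ν‖ := by
  simpa using lp.hasSum_norm (p := 1) (by simp) ν

theorem memℓp_one {f : S → ℝ} (hf : Summable fun j => |f j|) : Memℓp f 1 := by
  refine memℓp_gen ?_
  simpa using hf

theorem norm_apply_le (f : LInf S E) (j : S) : ‖f j‖ ≤ ‖f‖ :=
  lp.norm_apply_le_norm (by simp) f j

theorem summable_bound (ν : L1 S) (f : LInf S E) : Summable fun j => |ν j| * ‖f‖ :=
  (hasSum_norm_L1 ν).summable.mul_right _

variable [NormedSpace ℝ E]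

theorem norm_smul_le_bound (ν : L1 S) (f : LInf S E) (j : S) : ‖ν j • f j‖ ≤ |ν j| * ‖f‖ := by
  rw [norm_smul, Real.norm_eq_abs]
  exact mul_le_mul_of_nonneg_left (norm_apply_le f j) (abs_nonneg _)

theorem summable_norm_smul (ν : L1 S) (f : LInf S E) : Summable fun j => ‖ν j • f j‖ :=
  Summable.of_nonneg_of_le (fun _ => norm_nonneg _) (norm_smul_le_bound ν f) (summable_bound ν f)

open Classical in
/-- The unit mass at `i`. -/
def unitMass (i : S) : L1 S := lp.single 1 i 1

open Classical in
theorem unitMass_apply (i j : S) : unitMass i j = if i = j then 1 else 0 := by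
  unfold unitMass
  rw [lp.single_apply, Pi.single_apply]
  simp [eq_comm]

theorem norm_unitMass (i : S) : ‖unitMass i‖ = 1 := by
  classical
  unfold unitMass
  rw [lp.norm_single (by simp)]
  simp

theorem hasSum_unitMass (ν : L1 S) : HasSum (fun i => ν i • unitMass i) ν := by
  classical
  have h := lp.hasSum_single (p := 1) (by simp) ν
  convert h using 2 with i
  ext j
  simp [unitMass, Pi.single_apply]

theorem hasSum_clm (A : L1 S →L[ℝ] E) (ν : L1 S) :
    HasSum (fun i => ν i • A (unitMass i)) (A ν) := by
  simpa using (hasSum_unitMass ν).mapL A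

theorem clm_ext {A B : L1 S →L[ℝ] E} (h : ∀ i, A (unitMass i) = B (unitMass i)) : A = B := by
  ext1 ν
  have hA := hasSum_clm A ν
  simp only [h] at hA
  exact hA.unique (hasSum_clm B ν)

/-- Every `ν` is the norm-convergent sum of its weighted unit masses. This turns estimates on rows
that are uniform in the state, such as the ergodicity assumption, into operator norm estimates. -/
theorem opNorm_le_of_unitMass (A : L1 S →L[ℝ] E) {c : ℝ} (hc : 0 ≤ c)
    (h : ∀ i, ‖A (unitMass i)‖ ≤ c) : ‖A‖ ≤ c := by
  refine A.opNorm_le_bound hc fun ν => ?_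
  rw [mul_comm, ← (hasSum_clm A ν).tsum_eq]
  refine tsum_of_norm_bounded ((hasSum_norm_L1 ν).mul_right c) fun i => ?_
  rw [norm_smul, Real.norm_eq_abs]
  exact mul_le_mul_of_nonneg_left (h i) (abs_nonneg _)

variable [CompleteSpace E]

theorem summable_smul (ν : L1 S) (f : LInf S E) : Summable fun j => ν j • f j :=
  (summable_norm_smul ν f).of_norm

/-- The bilinear pairing `(ν, f) ↦ ∑ j, ν_j f_j` of `ℓ¹(S)` with `ℓ^∞(S, E)`. -/
def pairing (S E : Type*) [NormedAddCommGroup E] [NormedSpace ℝ E] [CompleteSpace E] :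
    L1 S →L[ℝ] LInf S E →L[ℝ] E :=
  LinearMap.mkContinuous₂
    (LinearMap.mk₂ ℝ (fun ν f => ∑' j, ν j • f j)
      (fun ν ν' f => by
        rw [← (summable_smul ν f).tsum_add (summable_smul ν' f)]
        simp [add_smul])
      (fun c ν f => by
        rw [← (summable_smul ν f).tsum_const_smul]
        simp [mul_smul])
      (fun ν f f' => by
        rw [← (summable_smul ν f).tsum_add (summable_smul ν f')]
        simp)
      (fun c ν f => by
        rw [← (summable_smul ν f).tsum_const_smul]
        simp [smul_comm c]))
    1 (fun ν f => by
      rw [one_mul]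
      refine tsum_of_norm_bounded ?_ (norm_smul_le_bound ν f)
      exact (hasSum_norm_L1 ν).mul_right _)

theorem pairing_apply (ν : L1 S) (f : LInf S E) : pairing S E ν f = ∑' j, ν j • f j := rfl

theorem hasSum_pairing (ν : L1 S) (f : LInf S E) :
    HasSum (fun j => ν j • f j) (pairing S E ν f) :=
  (summable_smul ν f).hasSum

theorem norm_pairing_le (ν : L1 S) (f : LInf S E) : ‖pairing S E ν f‖ ≤ ‖ν‖ * ‖f‖ :=
  tsum_of_norm_bounded ((hasSum_norm_L1 ν).mul_right _) (norm_smul_le_bound ν f)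

theorem pairing_unitMass (i : S) (f : LInf S E) : pairing S E (unitMass i) f = f i := by
  classical
  rw [pairing_apply, tsum_eq_single i]
  · simp [unitMass_apply]
  · intro j hj
    simp [unitMass_apply, hj.symm]

/-- The action `ν ↦ ν M` of a matrix on row vectors. -/
def act (S : Type*) : RowMatrix S →L[ℝ] L1 S →L[ℝ] L1 S := (pairing S (L1 S)).flip

theorem act_unitMass (M : RowMatrix S) (i : S) : act S M (unitMass i) = M i :=
  pairing_unitMass i M

theorem norm_act_le (M : RowMatrix S) : ‖act S M‖ ≤ ‖M‖ :=
  opNorm_le_of_unitMass _ (norm_nonneg _) fun i => by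
    rw [act_unitMass]
    exact norm_apply_le M i

theorem hasSum_act (M : RowMatrix S) (ν : L1 S) (j : S) :
    HasSum (fun i => ν i * M.entry i j) (act S M ν j) := by
  have h := (hasSum_clm (act S M) ν).mapL (lp.evalCLM ℝ (fun _ : S => ℝ) (1 : ℝ≥0∞) j)
  simp only [map_smul, act_unitMass] at h
  exact h

/-- The total mass of an absolutely summable sequence. -/
def mass (S : Type*) : L1 S →L[ℝ] ℝ :=
  (pairing S ℝ).flip ⟨fun _ => 1, memℓp_infty ⟨1, by rintro _ ⟨i, rfl⟩; simp⟩⟩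

theorem hasSum_mass (ν : L1 S) : HasSum (fun j => ν j) (mass S ν) := by
  have h := hasSum_pairing ν
    (⟨fun _ => 1, memℓp_infty ⟨1, by rintro _ ⟨i, rfl⟩; simp⟩⟩ : LInf S ℝ)
  simp only [smul_eq_mul, mul_one] at h
  exact h

theorem mass_unitMass (i : S) : mass S (unitMass i) = 1 := by
  simp [mass, pairing_unitMass]

theorem exists_of_rows (M : S → S → ℝ) (c : ℝ) (h : ∀ i, ∃ a ≤ c, HasSum (fun j => |M i j|) a) :
    ∃ A : RowMatrix S, ∀ i j, A.entry i j = M i j := by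
  have hM : ∀ i, Memℓp (M i) 1 := fun i => memℓp_one (h i).choose_spec.2.summable
  refine ⟨⟨fun i => ⟨M i, hM i⟩, memℓp_infty ⟨c, ?_⟩⟩, fun i j => rfl⟩
  rintro _ ⟨i, rfl⟩
  obtain ⟨a, hac, ha⟩ := h i
  have := (hasSum_norm_L1 (⟨M i, hM i⟩ : L1 S)).unique ha
  exact this.trans_le hac

open Classical in
/-- The matrix with the given entries, or `0` if these do not define a `RowMatrix`. -/
def ofEntries (M : S → S → ℝ) : RowMatrix S :=
  if h : ∃ A : RowMatrix S, ∀ i j, A.entry i j = M i j then h.choose else 0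

theorem entry_ofEntries {M : S → S → ℝ} {c : ℝ}
    (h : ∀ i, ∃ a ≤ c, HasSum (fun j => |M i j|) a) (i j : S) :
    (ofEntries M).entry i j = M i j := by
  have h' := exists_of_rows M c h
  unfold ofEntries
  rw [dif_pos h']
  exact h'.choose_spec i j

/-- Scheffé's lemma in `ℓ¹(S)`: for sequences of total mass zero which are nonnegative off `i`,
entrywise convergence implies convergence in norm. -/
theorem tendsto_of_tendsto_apply {ι : Type*} {l : Filter ι} {a : ι → L1 S} {b : L1 S} (i : S)
    (ha : ∀ᶠ n in l, mass S (a n) = 0) (hb : mass S b = 0)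
    (hpos : ∀ᶠ n in l, ∀ j, i ≠ j → 0 ≤ a n j)
    (hlim : ∀ j, Filter.Tendsto (fun n => a n j) l (𝓝 (b j))) :
    Filter.Tendsto a l (𝓝 b) := by
  classical
  -- Only the positive parts `(b_j - a_j)⁺` are dominated: by `|b_j|` off `i`, where `a_j ≥ 0`, and
  -- by `|b_i| + 1` at `i`, eventually. As `a - b` has total mass zero, `‖a - b‖` is twice their
  -- sum.
  have key : Filter.Tendsto (fun n => ∑' j, max (b j - a n j) 0) l (𝓝 (∑' _ : S, (0 : ℝ))) := by
    refine tendsto_tsum_of_dominated_convergence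
      (bound := fun j => |b j| + |unitMass i j|)
      ((hasSum_norm_L1 b).summable.add (hasSum_norm_L1 (unitMass i)).summable) ?_ ?_
    · intro j
      have : Filter.Tendsto (fun n => max (b j - a n j) 0) l (𝓝 (max (b j - b j) 0)) :=
        ((tendsto_const_nhds.sub (hlim j)).max tendsto_const_nhds)
      simpa using this
    · have hi : ∀ᶠ n in l, |b i - a n i| < 1 := by
        have : Filter.Tendsto (fun n => |b i - a n i|) l (𝓝 |b i - b i|) :=
          (tendsto_const_nhds.sub (hlim i)).abs
        rw [sub_self, abs_zero] at this
        exact this.eventually_lt_const one_pos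
      filter_upwards [hpos, hi] with n hn hni j
      rw [Real.norm_eq_abs, abs_of_nonneg (le_max_right _ _)]
      refine max_le ?_ (by positivity)
      by_cases hij : i = j
      · subst hij
        have := le_abs_self (b i - a n i)
        have := abs_nonneg (b i)
        simp only [unitMass_apply, if_true, abs_one]
        linarith
      · have := hn j hij
        have := le_abs_self (b j)
        have := abs_nonneg (unitMass i j)
        linarith
  rw [tsum_zero] at key
  rw [tendsto_iff_norm_sub_tendsto_zero]
  have key2 := key.const_mul 2
  rw [mul_zero] at key2
  refine key2.congr' ?_
  filter_upwards [ha] with n hn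
  have h1 := hasSum_norm_L1 (a n - b)
  have h2 : HasSum (fun j => (a n - b) j) 0 := by
    have := hasSum_mass (a n - b)
    rwa [map_sub, hn, hb, sub_zero] at this
  have h3 := h1.sub h2
  rw [sub_zero] at h3
  rw [← h3.tsum_eq, ← tsum_mul_left]
  refine tsum_congr fun j => ?_
  simp only [lp.coeFn_sub, Pi.sub_apply]
  rcases le_total (a n j) (b j) with h | h
  · rw [max_eq_left (by linarith), abs_of_nonpos (by linarith)]
    ring
  · rw [max_eq_right (by linarith), abs_of_nonneg (by linarith)]
    ring

end RowMatrix

end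

/-! ### Contraction semigroups and the deviation operator. -/

noncomputable section

open Set Filter MeasureTheory

/-- `U` is a one-parameter semigroup of contractions on `V`. -/
structure IsContractionSemigroup {V : Type*} [NormedAddCommGroup V] [NormedSpace ℝ V]
    (U : ℝ → V →L[ℝ] V) : Prop where
  norm_le : ∀ t, 0 ≤ t → ‖U t‖ ≤ 1
  zero : U 0 = 1
  add : ∀ s t, 0 ≤ s → 0 ≤ t → U (s + t) = U s * U t

theorem hasDerivWithinAt_comp_sub_Ici {E : Type*} [NormedAddCommGroup E] [NormedSpace ℝ E]
    {f : ℝ → E} {f' : E} (hf : HasDerivWithinAt f f' (Ici 0) 0) (t : ℝ) :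
    HasDerivWithinAt (fun s => f (s - t)) f' (Ici t) t := by
  have hs : HasDerivWithinAt (fun s : ℝ => s - t) 1 (Ici t) t :=
    ((hasDerivAt_id t).sub_const t).hasDerivWithinAt
  have hf' : HasDerivWithinAt f f' (Ici 0) (t - t) := by rwa [sub_self]
  have := HasDerivWithinAt.scomp (h := fun s : ℝ => s - t) t hf' hs
    (fun s (hs : t ≤ s) => mem_Ici.2 (sub_nonneg.2 hs))
  rw [one_smul] at this
  exact this

namespace IsContractionSemigroup

variable {V : Type*} [NormedAddCommGroup V] [NormedSpace ℝ V] {U : ℝ → V →L[ℝ] V}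

theorem norm_apply_le (hU : IsContractionSemigroup U) {t : ℝ} (ht : 0 ≤ t) (v : V) :
    ‖U t v‖ ≤ ‖v‖ := by
  simpa using (U t).le_of_opNorm_le (hU.norm_le t ht) v

theorem orbit_add (hU : IsContractionSemigroup U) {s t : ℝ} (hs : 0 ≤ s) (ht : 0 ≤ t) (v : V) :
    U (s + t) v = U s (U t v) := by
  rw [hU.add s t hs ht]
  rfl

theorem commute (hU : IsContractionSemigroup U) {s t : ℝ} (hs : 0 ≤ s) (ht : 0 ≤ t) :
    U s * U t = U t * U s := by
  rw [← hU.add s t hs ht, ← hU.add t s ht hs, add_comm]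

theorem norm_orbit_sub_orbit_le (hU : IsContractionSemigroup U) {s t : ℝ} (hs : 0 ≤ s)
    (ht : 0 ≤ t) (v : V) : ‖U t v - U s v‖ ≤ ‖U |t - s| v - v‖ := by
  wlog hst : s ≤ t generalizing s t
  · rw [norm_sub_rev, abs_sub_comm]
    exact this ht hs (le_of_not_ge hst)
  rw [abs_of_nonneg (sub_nonneg.2 hst)]
  have h := hU.orbit_add hs (sub_nonneg.2 hst) v
  rw [add_sub_cancel] at h
  rw [h, ← map_sub]
  exact hU.norm_apply_le hs _

theorem continuousOn_orbit (hU : IsContractionSemigroup U) {v : V}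
    (hv : ContinuousWithinAt (fun t => U t v) (Ici 0) 0) :
    ContinuousOn (fun t => U t v) (Ici 0) := by
  intro s hs
  have h1 : Tendsto (fun t : ℝ => |t - s|) (𝓝[Ici 0] s) (𝓝[Ici 0] 0) := by
    refine tendsto_nhdsWithin_iff.2 ⟨?_, Eventually.of_forall fun t => mem_Ici.2 (abs_nonneg _)⟩
    have : Continuous fun t : ℝ => |t - s| := by fun_prop
    simpa using (this.tendsto s).mono_left nhdsWithin_le_nhds
  have h2 : Tendsto (fun t => ‖U t v - v‖) (𝓝[Ici 0] 0) (𝓝 0) := by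
    have := (hv.tendsto.sub_const v).norm
    simpa [hU.zero] using this
  refine tendsto_iff_norm_sub_tendsto_zero.2 ?_
  refine squeeze_zero' (Eventually.of_forall fun _ => norm_nonneg _) ?_ (h2.comp h1)
  filter_upwards [self_mem_nhdsWithin] with t ht
  exact hU.norm_orbit_sub_orbit_le hs ht v

theorem hasDerivWithinAt_orbit (hU : IsContractionSemigroup U) {v w : V}
    (hv : HasDerivWithinAt (fun t => U t v) w (Ici 0) 0) {t : ℝ} (ht : 0 ≤ t) :
    HasDerivWithinAt (fun t => U t v) (U t w) (Ici t) t := by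
  have h1 : HasDerivWithinAt (fun s => U (s - t) v) w (Ici t) t := hasDerivWithinAt_comp_sub_Ici hv t
  have h2 := (U t).hasFDerivAt.comp_hasDerivWithinAt t h1
  refine h2.congr (fun s hs => ?_) ?_
  · have := hU.orbit_add ht (sub_nonneg.2 hs) v
    rwa [add_sub_cancel] at this
  · simp [hU.zero]

/-- The orbit has right derivative `U t w`, of norm at most `‖w‖`, so the mean value inequality for
right derivatives applies. -/
theorem norm_orbit_sub_le (hU : IsContractionSemigroup U) {v w : V}
    (hv : HasDerivWithinAt (fun t => U t v) w (Ici 0) 0) {t : ℝ} (ht : 0 ≤ t) :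
    ‖U t v - v‖ ≤ ‖w‖ * t := by
  have h := norm_image_sub_le_of_norm_deriv_right_le_segment (f := fun t => U t v)
    (f' := fun t => U t w) (a := 0) (b := t) (C := ‖w‖)
    ((hU.continuousOn_orbit hv.continuousWithinAt).mono Icc_subset_Ici_self)
    (fun s hs => hU.hasDerivWithinAt_orbit hv hs.1)
    (fun s hs => hU.norm_apply_le hs.1 w) t ⟨ht, le_rfl⟩
  simpa [hU.zero] using h

/-- The mean value inequality again, now for `U t v - t • w`, with right derivative `U t w - w`. A
quadratic remainder uniform over unit masses is what yields differentiability in operator norm. -/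
theorem norm_orbit_sub_sub_le (hU : IsContractionSemigroup U) {v w : V} {c : ℝ}
    (hv : HasDerivWithinAt (fun t => U t v) w (Ici 0) 0)
    (hc : ∀ t, 0 ≤ t → ‖U t w - w‖ ≤ c * t) {t : ℝ} (ht : 0 ≤ t) :
    ‖U t v - v - t • w‖ ≤ c * t * t := by
  have hc0 : 0 ≤ c := by simpa using (norm_nonneg _).trans (hc 1 zero_le_one)
  have hlin : ∀ s : ℝ, HasDerivAt (fun s : ℝ => s • w) w s := fun s => by
    simpa using (hasDerivAt_id s).smul_const w
  have h := norm_image_sub_le_of_norm_deriv_right_le_segment (f := fun t => U t v - t • w)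
    (f' := fun t => U t w - w) (a := 0) (b := t) (C := c * t)
    (((hU.continuousOn_orbit hv.continuousWithinAt).mono Icc_subset_Ici_self).sub
      (by fun_prop))
    (fun s hs => (hU.hasDerivWithinAt_orbit hv hs.1).sub (hlin s).hasDerivWithinAt)
    (fun s hs => (hc s hs.1).trans (mul_le_mul_of_nonneg_left hs.2.le hc0)) t ⟨ht, le_rfl⟩
  rw [sub_right_comm]
  simpa [hU.zero] using h

theorem hasDerivWithinAt_right (hU : IsContractionSemigroup U) {A : V →L[ℝ] V}
    (hA : HasDerivWithinAt U A (Ici 0) 0) {t : ℝ} (ht : 0 ≤ t) :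
    HasDerivWithinAt U (U t * A) (Ici t) t := by
  have h1 : HasDerivWithinAt (fun s => U (s - t)) A (Ici t) t := hasDerivWithinAt_comp_sub_Ici hA t
  refine (h1.const_mul (U t)).congr (fun s hs => ?_) ?_
  · rw [← hU.add t (s - t) ht (sub_nonneg.2 hs), add_sub_cancel]
  · simp [hU.zero]

/-- Both sides are the derivative at `s = 0` of the same function `U t * U s = U s * U t`. -/
theorem commute_generator (hU : IsContractionSemigroup U) {A : V →L[ℝ] V}
    (hA : HasDerivWithinAt U A (Ici 0) 0) {t : ℝ} (ht : 0 ≤ t) : U t * A = A * U t := by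
  have h1 := hA.const_mul (U t)
  have h2 := hA.mul_const (U t)
  refine (uniqueDiffOn_Ici (0 : ℝ) 0 self_mem_Ici).eq_deriv (Ici 0) h1 (h2.congr ?_ ?_)
  · intro s hs
    exact hU.commute ht hs
  · exact hU.commute ht le_rfl

theorem continuousOn (hU : IsContractionSemigroup U) {A : V →L[ℝ] V}
    (hA : ∀ v, HasDerivWithinAt (fun t => U t v) (A v) (Ici 0) 0) : ContinuousOn U (Ici 0) := by
  refine (LipschitzOnWith.of_dist_le_mul (K := ‖A‖₊) fun t ht s hs => ?_).continuousOn
  rw [dist_eq_norm, Real.dist_eq]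
  refine ContinuousLinearMap.opNorm_le_bound _ (by positivity) fun v => ?_
  refine (hU.norm_orbit_sub_orbit_le hs ht v).trans ?_
  refine (hU.norm_orbit_sub_le (hA v) (abs_nonneg _)).trans ?_
  rw [coe_nnnorm, mul_right_comm]
  exact mul_le_mul_of_nonneg_right (A.le_opNorm v) (abs_nonneg _)

theorem hasDerivWithinAt_zero (hU : IsContractionSemigroup U) {A : V →L[ℝ] V} {c : ℝ}
    (h : ∀ t, 0 ≤ t → ‖U t - 1 - t • A‖ ≤ c * t * t) : HasDerivWithinAt U A (Ici 0) 0 := by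
  rw [hasDerivWithinAt_iff_isLittleO]
  have h1 : (fun t : ℝ => U t - U 0 - (t - 0) • A) =O[𝓝[Ici 0] 0] fun t : ℝ => t * t := by
    refine Asymptotics.IsBigO.of_bound c ?_
    filter_upwards [self_mem_nhdsWithin] with t ht
    rw [hU.zero, sub_zero, Real.norm_of_nonneg (mul_self_nonneg t), ← mul_assoc]
    exact h t ht
  refine h1.trans_isLittleO ?_
  have h2 : (fun t : ℝ => t) =o[𝓝[Ici 0] 0] fun _ => (1 : ℝ) :=
    (Asymptotics.isLittleO_one_iff ℝ).2 (tendsto_id.mono_left nhdsWithin_le_nhds)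
  simpa using h2.mul_isBigO (Asymptotics.isBigO_refl (fun t : ℝ => t) _)

/-- The deviation operator `∫₀^∞ (U_t - Π) dt`. -/
def deviation (U : ℝ → V →L[ℝ] V) (Pi : V →L[ℝ] V) : V →L[ℝ] V := ∫ t in Ioi (0 : ℝ), (U t - Pi)

variable {A Pi : V →L[ℝ] V} {C r : ℝ}

theorem integrableOn_deviation (hcont : ContinuousOn U (Ici 0)) (hr : 0 < r)
    (herg : ∀ t, 0 < t → ‖U t - Pi‖ ≤ C * Real.exp (-r * t)) :
    IntegrableOn (fun t => U t - Pi) (Ioi 0) := by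
  refine Integrable.mono' ((exp_neg_integrableOn_Ioi 0 hr).const_mul C) ?_ ?_
  · exact ((hcont.sub continuousOn_const).mono Ioi_subset_Ici_self).aestronglyMeasurable
      measurableSet_Ioi
  · exact (ae_restrict_iff' measurableSet_Ioi).2 (Eventually.of_forall herg)

theorem norm_deviation_le (hr : 0 < r)
    (herg : ∀ t, 0 < t → ‖U t - Pi‖ ≤ C * Real.exp (-r * t)) :
    ‖deviation U Pi‖ ≤ C / r := by
  refine (norm_integral_le_of_norm_le ((exp_neg_integrableOn_Ioi 0 hr).const_mul C)
    ((ae_restrict_iff' measurableSet_Ioi).2 (Eventually.of_forall herg))).trans ?_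
  rw [integral_const_mul, integral_exp_mul_Ioi (neg_neg_of_pos hr)]
  simp [div_eq_mul_inv]

theorem tendsto_of_ergodic (hr : 0 < r)
    (herg : ∀ t, 0 < t → ‖U t - Pi‖ ≤ C * Real.exp (-r * t)) : Tendsto U atTop (𝓝 Pi) := by
  rw [tendsto_iff_norm_sub_tendsto_zero]
  refine squeeze_zero' (Eventually.of_forall fun _ => norm_nonneg _)
    ((eventually_gt_atTop 0).mono herg) ?_
  have h : Tendsto (fun t : ℝ => Real.exp (-r * t)) atTop (𝓝 0) :=
    Real.tendsto_exp_atBot.comp (tendsto_id.const_mul_atTop_of_neg (neg_neg_of_pos hr))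
  simpa using h.const_mul C

variable [CompleteSpace V]

/-- Because `A * Pi = 0`, the integrand is the right derivative of `U`. Its integral over `[0, T]`
is `U T - 1`, and `U T` tends to `Pi`. -/
theorem integral_generator_mul (hU : IsContractionSemigroup U) (hcont : ContinuousOn U (Ici 0))
    (hA : HasDerivWithinAt U A (Ici 0) 0) (hr : 0 < r)
    (herg : ∀ t, 0 < t → ‖U t - Pi‖ ≤ C * Real.exp (-r * t))
    (hAPi : A * Pi = 0) : ∫ t in Ioi (0 : ℝ), A * (U t - Pi) = Pi - 1 := by
  have hint := (integrableOn_deviation hcont hr herg).const_mul A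
  have h1 := intervalIntegral_tendsto_integral_Ioi 0 hint tendsto_id
  refine tendsto_nhds_unique h1 (((tendsto_of_ergodic hr herg).sub_const 1).congr' ?_)
  filter_upwards [eventually_ge_atTop 0] with T hT
  have hA' : ∀ t, A * (U t - Pi) = A * U t := fun t => by rw [mul_sub, hAPi, sub_zero]
  simp only [hA', id]
  have hc : ContinuousOn U (Icc 0 T) := hcont.mono Icc_subset_Ici_self
  rw [intervalIntegral.integral_eq_sub_of_hasDeriv_right_of_le hT hc, hU.zero]
  · intro t ht
    rw [← hU.commute_generator hA ht.1.le]
    exact (hU.hasDerivWithinAt_right hA ht.1.le).mono Ioi_subset_Ici_self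
  · refine ContinuousOn.intervalIntegrable ?_
    rw [uIcc_of_le hT]
    exact continuousOn_const.mul hc

theorem generator_mul_deviation (hU : IsContractionSemigroup U) (hcont : ContinuousOn U (Ici 0))
    (hA : HasDerivWithinAt U A (Ici 0) 0) (hr : 0 < r)
    (herg : ∀ t, 0 < t → ‖U t - Pi‖ ≤ C * Real.exp (-r * t))
    (hAPi : A * Pi = 0) : A * deviation U Pi = Pi - 1 := by
  rw [← integral_generator_mul hU hcont hA hr herg hAPi]
  exact (integral_const_mul_of_integrable (integrableOn_deviation hcont hr herg)).symm

theorem deviation_mul_generator (hU : IsContractionSemigroup U) (hcont : ContinuousOn U (Ici 0))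
    (hA : HasDerivWithinAt U A (Ici 0) 0) (hr : 0 < r)
    (herg : ∀ t, 0 < t → ‖U t - Pi‖ ≤ C * Real.exp (-r * t))
    (hAPi : A * Pi = 0) (hPiA : Pi * A = 0) : deviation U Pi * A = Pi - 1 := by
  rw [← integral_generator_mul hU hcont hA hr herg hAPi]
  refine (integral_mul_const_of_integrable (integrableOn_deviation hcont hr herg)).symm.trans ?_
  refine setIntegral_congr_fun measurableSet_Ioi fun t ht => ?_
  have := hU.commute_generator hA (le_of_lt ht)
  simp only [mul_sub, sub_mul, hAPi, hPiA, this]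

end IsContractionSemigroup

end

/-! ### The bordered operator, and the transition function as a semigroup on `ℓ¹(S)`. -/

noncomputable section

open Set Filter MeasureTheory RowMatrix

/-- `Q` is singular, but `-D` inverts it modulo `P`, and adding the idempotent `E` repairs the
defect. The last identity recovers `D` from the inverse and `E` alone, eliminating `P`; this matters
because `E` will not depend on the parameter while `P` does. -/
theorem bordered_inverse {A : Type*} [Ring A] {Q D E P : A} (hEE : E * E = E) (hEP : E * P = E)
    (hPE : P * E = P) (hPP : P * P = P) (hEQ : E * Q = 0) (hQP : Q * P = 0) (hPQ : P * Q = 0)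
    (hED : E * D = 0) (hQD : Q * D = P - 1) (hDQ : D * Q = P - 1) :
    (E - Q) * (D * (1 - E) + P) = 1 ∧ (D * (1 - E) + P) * (E - Q) = 1 ∧
      D = (D * (1 - E) + P) * (1 - (D * (1 - E) + P) * E) := by
  have h1 : (E - Q) * (D * (1 - E) + P) = 1 := by
    calc (E - Q) * (D * (1 - E) + P)
        = (E * D) * (1 - E) - (Q * D) * (1 - E) + E * P - Q * P := by noncomm_ring
      _ = 1 - P + (P * E - E) + E := by
        rw [hED, hQD, hEP, hQP]
        noncomm_ring
      _ = 1 := by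
        rw [hPE]
        abel
  have h2 : (D * (1 - E) + P) * (E - Q) = 1 := by
    calc (D * (1 - E) + P) * (E - Q)
        = D * (E - E * E) - D * Q + D * (E * Q) + P * E - P * Q := by noncomm_ring
      _ = 1 := by
        rw [hEE, hDQ, hEQ, hPE, hPQ, sub_self]
        noncomm_ring
  -- `E - Q` has a left inverse by `h2` and kills `D * P`, since `E * D = 0` and `Q * D * P = (P -
  -- 1) * P = 0`.
  have h3 : D * P = 0 := by
    calc D * P = ((D * (1 - E) + P) * (E - Q)) * (D * P) := by rw [h2, one_mul]
      _ = (D * (1 - E) + P) * ((E * D) * P - (Q * D) * P) := by noncomm_ring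
      _ = 0 := by
        rw [hED, hQD, sub_mul, hPP]
        noncomm_ring
  refine ⟨h1, h2, ?_⟩
  have h4 : (D * (1 - E) + P) * E = P := by
    calc (D * (1 - E) + P) * E = D * (E - E * E) + P * E := by noncomm_ring
      _ = P := by rw [hEE, hPE, sub_self, mul_zero, zero_add]
  rw [h4]
  calc D = D - D * P - D * E + D * E + (P - P) := by rw [h3]; abel
    _ = D - D * P - D * E + D * (E * P) + (P - P * P) := by rw [hEP, hPP]
    _ = (D * (1 - E) + P) * (1 - P) := by noncomm_ring

namespace RowMatrix

variable {S : Type*}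

/-- The operator `ν ↦ (∑ j, ν_j) v`. -/
def massSmul (v : L1 S) : L1 S →L[ℝ] L1 S := (mass S).smulRight v

theorem massSmul_apply (v ν : L1 S) : massSmul v ν = mass S ν • v := rfl

theorem norm_massSmul_le (v : L1 S) : ‖massSmul v‖ ≤ ‖v‖ :=
  opNorm_le_of_unitMass _ (norm_nonneg _) fun i => by
    simp [massSmul_apply, mass_unitMass]

theorem mul_massSmul (B : L1 S →L[ℝ] L1 S) (v : L1 S) : B * massSmul v = massSmul (B v) := by
  ext1 ν
  simp [massSmul_apply]

theorem massSmul_mul {B : L1 S →L[ℝ] L1 S} {c : ℝ} (hB : ∀ i, mass S (B (unitMass i)) = c)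
    (v : L1 S) : massSmul v * B = c • massSmul v :=
  clm_ext fun i => by simp [massSmul_apply, hB, mass_unitMass]

theorem mass_nonneg_eq_norm {ν : L1 S} (h : ∀ i, 0 ≤ ν i) : mass S ν = ‖ν‖ := by
  have h1 := hasSum_norm_L1 ν
  simp only [fun i => abs_of_nonneg (h i)] at h1
  exact (hasSum_mass ν).unique h1

/-- The operator `ν ↦ ν p(t)`. -/
def transOp (p : ℝ → S → S → ℝ) (t : ℝ) : L1 S →L[ℝ] L1 S := act S (ofEntries (p t))

end RowMatrix

theorem IsConservative.mass_act_unitMass {S : Type*} {Q : RowMatrix S} (hQ : IsConservative Q)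
    (i : S) : mass S (act S Q (unitMass i)) = 0 := by
  rw [act_unitMass]
  exact (hasSum_mass _).unique (hQ.row_sum i)

namespace IsTransitionFunction

variable {S : Type*} {Q : RowMatrix S} {p : ℝ → S → S → ℝ}

theorem entry_ofEntries (hp : IsTransitionFunction Q p) {t : ℝ} (ht : 0 ≤ t) (i j : S) :
    (ofEntries (p t)).entry i j = p t i j := by
  refine RowMatrix.entry_ofEntries (c := 1) (fun i => ⟨1, le_rfl, ?_⟩) i j
  simpa only [abs_of_nonneg (hp.nonneg t ht i _)] using hp.row_sum t ht i

theorem transOp_unitMass_apply (hp : IsTransitionFunction Q p) {t : ℝ} (ht : 0 ≤ t) (i j : S) :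
    transOp p t (unitMass i) j = p t i j := by
  rw [transOp, act_unitMass]
  exact hp.entry_ofEntries ht i j

theorem mass_transOp_unitMass (hp : IsTransitionFunction Q p) {t : ℝ} (ht : 0 ≤ t) (i : S) :
    mass S (transOp p t (unitMass i)) = 1 := by
  have h := hasSum_mass (transOp p t (unitMass i))
  simp only [hp.transOp_unitMass_apply ht] at h
  exact h.unique (hp.row_sum t ht i)

theorem norm_transOp_unitMass (hp : IsTransitionFunction Q p) {t : ℝ} (ht : 0 ≤ t) (i : S) :
    ‖transOp p t (unitMass i)‖ = 1 := by
  rw [← mass_nonneg_eq_norm, hp.mass_transOp_unitMass ht]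
  intro j
  rw [hp.transOp_unitMass_apply ht]
  exact hp.nonneg t ht i j

theorem isContractionSemigroup (hp : IsTransitionFunction Q p) :
    IsContractionSemigroup (transOp p) where
  norm_le t ht := opNorm_le_of_unitMass _ zero_le_one fun i => (hp.norm_transOp_unitMass ht i).le
  zero := clm_ext fun i => by
    ext j
    simp [hp.transOp_unitMass_apply le_rfl, hp.zero, unitMass_apply]
  add s t hs ht := clm_ext fun i => by
    ext j
    rw [hp.transOp_unitMass_apply (add_nonneg hs ht), add_comm]
    have h := hasSum_act (ofEntries (p s)) (transOp p t (unitMass i)) j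
    simp only [hp.transOp_unitMass_apply ht, hp.entry_ofEntries hs] at h
    exact (hp.chapman_kolmogorov t s ht hs i j).unique h

/-- The difference quotients of the `i`-th row have total mass zero and are nonnegative off `i`, and
so `tendsto_of_tendsto_apply` upgrades the entrywise derivative to one in `ℓ¹` norm. -/
theorem hasDerivWithinAt_orbit_unitMass (hp : IsTransitionFunction Q p) (hQ : IsConservative Q)
    (i : S) : HasDerivWithinAt (fun t => transOp p t (unitMass i)) (act S Q (unitMass i))
      (Ici 0) 0 := by
  rw [← hasDerivWithinAt_Ioi_iff_Ici, hasDerivWithinAt_iff_tendsto_slope' (by simp)]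
  have happ : ∀ t : ℝ, 0 < t → ∀ j,
      slope (fun t => transOp p t (unitMass i)) 0 t j = slope (fun t => p t i j) 0 t := by
    intro t ht j
    rw [slope_def_module, slope_def_module, lp.coeFn_smul, Pi.smul_apply, lp.coeFn_sub,
      Pi.sub_apply, hp.transOp_unitMass_apply ht.le, hp.transOp_unitMass_apply le_rfl]
  refine tendsto_of_tendsto_apply i ?_ (hQ.mass_act_unitMass i) ?_ fun j => ?_
  · filter_upwards [self_mem_nhdsWithin] with t ht
    rw [slope_def_module, map_smul, map_sub, hp.mass_transOp_unitMass (le_of_lt ht),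
      hp.mass_transOp_unitMass le_rfl, sub_self, smul_zero]
  · filter_upwards [self_mem_nhdsWithin] with t ht j hij
    rw [happ t ht, slope_def_field, hp.zero, if_neg hij, sub_zero, sub_zero]
    exact div_nonneg (hp.nonneg t (le_of_lt ht) i j) (le_of_lt ht)
  · have h := hp.deriv_zero i j
    rw [← hasDerivWithinAt_Ioi_iff_Ici, hasDerivWithinAt_iff_tendsto_slope' (by simp)] at h
    rw [act_unitMass]
    refine h.congr' ?_
    filter_upwards [self_mem_nhdsWithin] with t ht
    exact (happ t ht j).symm

/-- Boundedness of `Q` makes everything uniform in the starting state: `‖U_t - 1‖ ≤ ‖Q‖ t` on unit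
masses, and inserting this into the second-order estimate gives a remainder at most `‖Q‖² t²`. -/
theorem hasDerivWithinAt_transOp (hp : IsTransitionFunction Q p) (hQ : IsConservative Q) :
    HasDerivWithinAt (transOp p) (act S Q) (Ici 0) 0 := by
  have hU := hp.isContractionSemigroup
  have hbound : ∀ i, ‖act S Q (unitMass i)‖ ≤ ‖Q‖ := fun i => by
    rw [act_unitMass]
    exact norm_apply_le Q i
  have h1 : ∀ t, 0 ≤ t → ‖transOp p t - 1‖ ≤ ‖Q‖ * t := fun t ht =>
    opNorm_le_of_unitMass _ (by positivity) fun i => by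
      refine (hU.norm_orbit_sub_le (hp.hasDerivWithinAt_orbit_unitMass hQ i) ht).trans ?_
      exact mul_le_mul_of_nonneg_right (hbound i) ht
  refine hU.hasDerivWithinAt_zero (c := ‖Q‖ * ‖Q‖) fun t ht =>
    opNorm_le_of_unitMass _ (by positivity) fun i => ?_
  refine hU.norm_orbit_sub_sub_le (hp.hasDerivWithinAt_orbit_unitMass hQ i) (fun s hs => ?_) ht
  have h2 := (transOp p s - 1).le_of_opNorm_le_of_le (h1 s hs) (hbound i)
  rw [mul_right_comm]
  exact h2

theorem continuousOn_transOp (hp : IsTransitionFunction Q p) (hQ : IsConservative Q) :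
    ContinuousOn (transOp p) (Ici 0) :=
  hp.isContractionSemigroup.continuousOn fun v => by
    have := (hp.hasDerivWithinAt_transOp hQ).clm_apply (hasDerivWithinAt_const (0 : ℝ) (Ici 0) v)
    simpa using this

end IsTransitionFunction

/-! ### The invariant law and the deviation operator of an ergodic chain. -/

namespace SolvesInvariance

variable {S : Type*} {Q : RowMatrix S} {μ : S → ℝ}

/-- An invariant law as an element of `ℓ¹(S)`. -/
def law (h : SolvesInvariance Q μ) : L1 S := ⟨μ, memℓp_one h.sum_one.summable.abs⟩

theorem mass_law (h : SolvesInvariance Q μ) : mass S h.law = 1 :=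
  (hasSum_mass h.law).unique h.sum_one

theorem act_law (h : SolvesInvariance Q μ) : act S Q h.law = 0 := by
  ext j
  exact (hasSum_act Q h.law j).unique (h.mul_eq_zero j)

theorem norm_law (h : SolvesInvariance Q μ) (hpos : ∀ i, 0 < μ i) : ‖h.law‖ = 1 := by
  rw [← mass_nonneg_eq_norm fun i => (hpos i).le, h.mass_law]

theorem norm_transOp_sub_le (h : SolvesInvariance Q μ) {p : ℝ → S → S → ℝ}
    (hp : IsTransitionFunction Q p) {t c : ℝ} (ht : 0 ≤ t) (hc : 0 ≤ c)
    (hvar : ∀ i, varDist (p t i) μ ≤ c) : ‖transOp p t - massSmul h.law‖ ≤ c := by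
  refine opNorm_le_of_unitMass _ hc fun i => le_trans (le_of_eq ?_) (hvar i)
  rw [_root_.sub_apply, massSmul_apply, mass_unitMass, one_smul,
    ← (hasSum_norm_L1 _).tsum_eq, varDist]
  refine tsum_congr fun j => ?_
  rw [lp.coeFn_sub, Pi.sub_apply, hp.transOp_unitMass_apply ht]
  rfl

end SolvesInvariance

/-- `‖R‖ ≤ 2 C₀ / r + 1` for the inverse `R` of the operator `ν ↦ (∑ j, ν_j) δ_i - ν Q` on `ℓ¹(S)`,
and the deviation operator is `R (1 - R E)`, where `E ν = (∑ j, ν_j) δ_i`. -/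
theorem deviation_eq {S : Type*} {Q : RowMatrix S} {μ : S → ℝ} {p : ℝ → S → S → ℝ} {C₀ r : ℝ}
    (hC₀ : 0 < C₀) (hr : 0 < r) (hQ : IsConservative Q) (hμ : SolvesInvariance Q μ)
    (hpos : ∀ i, 0 < μ i) (hp : IsTransitionFunction Q p)
    (herg : ∀ i t, 0 < t → varDist (p t i) μ ≤ C₀ * Real.exp (-r * t)) (i₀ : S) :
    IntegrableOn (fun t => transOp p t - massSmul hμ.law) (Ioi 0) ∧
    ‖IsContractionSemigroup.deviation (transOp p) (massSmul hμ.law)‖ ≤ C₀ / r ∧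
    IsContractionSemigroup.deviation (transOp p) (massSmul hμ.law) * act S Q =
      massSmul hμ.law - 1 ∧
    ∃ R : L1 S →L[ℝ] L1 S, (massSmul (unitMass i₀) - act S Q) * R = 1 ∧
      R * (massSmul (unitMass i₀) - act S Q) = 1 ∧ ‖R‖ ≤ 2 * (C₀ / r) + 1 ∧
      IsContractionSemigroup.deviation (transOp p) (massSmul hμ.law) =
        R * (1 - R * massSmul (unitMass i₀)) := by
  set E := massSmul (unitMass i₀)
  set P := massSmul hμ.law
  set D := IsContractionSemigroup.deviation (transOp p) P
  have hU := hp.isContractionSemigroup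
  have hcont := hp.continuousOn_transOp hQ
  have hderiv := hp.hasDerivWithinAt_transOp hQ
  have herg' : ∀ t, 0 < t → ‖transOp p t - P‖ ≤ C₀ * Real.exp (-r * t) := fun t ht =>
    hμ.norm_transOp_sub_le hp ht.le (by positivity) fun i => herg i t ht
  have hint := IsContractionSemigroup.integrableOn_deviation hcont hr herg'
  have hDn : ‖D‖ ≤ C₀ / r := IsContractionSemigroup.norm_deviation_le hr herg'
  have hEE : E * E = E := by simp [E, mul_massSmul, massSmul_apply, mass_unitMass]
  have hEP : E * P = E := by
    rw [massSmul_mul (c := 1) fun i => ?_, one_smul]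
    simp [P, massSmul_apply, mass_unitMass, hμ.mass_law]
  have hPE : P * E = P := by simp [E, P, mul_massSmul, massSmul_apply, mass_unitMass]
  have hPP : P * P = P := by simp [P, mul_massSmul, massSmul_apply, hμ.mass_law]
  have hEQ : E * act S Q = 0 := by
    rw [massSmul_mul (c := 0) hQ.mass_act_unitMass, zero_smul]
  have hPQ : P * act S Q = 0 := by
    rw [massSmul_mul (c := 0) hQ.mass_act_unitMass, zero_smul]
  have hQP : act S Q * P = 0 := by
    rw [mul_massSmul, hμ.act_law]
    ext1 ν
    simp [massSmul_apply]
  -- Both `U_t` and `P` preserve total mass, so the integrand takes values in sequences of mass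
  -- zero, which `E` kills.
  have hED : E * D = 0 := by
    refine (integral_const_mul_of_integrable hint).symm.trans ?_
    refine setIntegral_eq_zero_of_forall_eq_zero fun t ht => ?_
    simp only [mul_sub, hEP]
    rw [massSmul_mul (c := 1) (hp.mass_transOp_unitMass (le_of_lt ht)), one_smul, sub_self]
  have hQD : act S Q * D = P - 1 :=
    IsContractionSemigroup.generator_mul_deviation hU hcont hderiv hr herg' hQP
  have hDQ : D * act S Q = P - 1 :=
    IsContractionSemigroup.deviation_mul_generator hU hcont hderiv hr herg' hQP hPQ
  obtain ⟨h1, h2, h3⟩ := bordered_inverse hEE hEP hPE hPP hEQ hQP hPQ hED hQD hDQ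
  refine ⟨hint, hDn, hDQ, D * (1 - E) + P, h1, h2, ?_, h3⟩
  have hEn : ‖E‖ ≤ 1 := (norm_massSmul_le _).trans (norm_unitMass i₀).le
  have hPn : ‖P‖ ≤ 1 := (norm_massSmul_le _).trans (hμ.norm_law hpos).le
  have h1E : ‖1 - E‖ ≤ 2 := by
    refine (norm_sub_le _ _).trans ?_
    have : ‖(1 : L1 S →L[ℝ] L1 S)‖ ≤ 1 := ContinuousLinearMap.norm_id_le
    linarith
  calc ‖D * (1 - E) + P‖ ≤ ‖D‖ * ‖1 - E‖ + ‖P‖ :=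
        (norm_add_le _ _).trans (by gcongr; exact norm_mul_le _ _)
    _ ≤ C₀ / r * 2 + 1 := by gcongr
    _ = 2 * (C₀ / r) + 1 := by ring

end

noncomputable section

open Set Filter RowMatrix

/-! ### Calculus for pairings of `ℓ¹`-valued maps with entrywise smooth families. -/

section BoundedFamilies

variable {X S E : Type*} [NormedAddCommGroup X] [NormedSpace ℝ X] [NormedAddCommGroup E]
  [NormedSpace ℝ E]

/-- `F₁` is the entrywise derivative of the family `F₀`, and it is locally bounded in norm. -/
structure IsFamilyDeriv (F₀ : X → LInf S E) (F₁ : X → LInf S (X →L[ℝ] E)) : Prop where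
  hasFDerivAt : ∀ x j, HasFDerivAt (fun y => F₀ y j) (F₁ x j) x
  bounded : ∀ x, ∃ B : ℝ, ∀ᶠ y in 𝓝 x, ‖F₁ y‖ ≤ B

namespace IsFamilyDeriv

variable {F₀ : X → LInf S E} {F₁ : X → LInf S (X →L[ℝ] E)} {F₂ : X → LInf S (X →L[ℝ] X →L[ℝ] E)}

theorem exists_ball (hF : IsFamilyDeriv F₀ F₁) (x : X) :
    ∃ B ε : ℝ, 0 < ε ∧ ∀ y ∈ Metric.ball x ε, ‖F₁ y‖ ≤ B := by
  obtain ⟨B, hB⟩ := hF.bounded x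
  obtain ⟨ε, hε, h⟩ := Metric.eventually_nhds_iff_ball.1 hB
  exact ⟨B, ε, hε, h⟩

/-- The mean value inequality on a ball holds with one Lipschitz constant for all entries, hence in
sup norm. -/
theorem continuous (hF : IsFamilyDeriv F₀ F₁) : Continuous F₀ := by
  refine continuous_iff_continuousAt.2 fun x => ?_
  obtain ⟨B, ε, hε, hB⟩ := hF.exists_ball x
  have hB0 : 0 ≤ B := (norm_nonneg _).trans (hB x (Metric.mem_ball_self hε))
  refine tendsto_iff_norm_sub_tendsto_zero.2 ?_
  have hlim : Tendsto (fun y => B * ‖y - x‖) (𝓝 x) (𝓝 0) := by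
    have : Continuous fun y => B * ‖y - x‖ := by fun_prop
    simpa using this.tendsto x
  refine squeeze_zero' (Eventually.of_forall fun _ => norm_nonneg _) ?_ hlim
  filter_upwards [Metric.ball_mem_nhds x hε] with y hy
  refine lp.norm_le_of_forall_le (by positivity) fun j => ?_
  exact (convex_ball x ε).norm_image_sub_le_of_norm_hasFDerivWithin_le
    (f := fun y => F₀ y j) (fun z _ => (hF.hasFDerivAt z j).hasFDerivWithinAt)
    (fun z hz => (RowMatrix.norm_apply_le _ j).trans (hB z hz)) (Metric.mem_ball_self hε) hy

variable [CompleteSpace E]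

/-- Termwise differentiation of the series on a ball where the derivatives are dominated by the
summable `|ν j| * B`. -/
theorem hasFDerivAt_pairing_const (hF : IsFamilyDeriv F₀ F₁) (ν : L1 S) (x : X) :
    HasFDerivAt (fun y => pairing S E ν (F₀ y)) (pairing S (X →L[ℝ] E) ν (F₁ x)) x := by
  obtain ⟨B, ε, hε, hB⟩ := hF.exists_ball x
  refine hasFDerivAt_tsum_of_isPreconnected (u := fun j => |ν j| * B) (s := Metric.ball x ε)
    (x₀ := x) (f := fun j y => ν j • F₀ y j) (f' := fun j y => ν j • F₁ y j)
    ((hasSum_norm_L1 ν).summable.mul_right B) Metric.isOpen_ball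
    (convex_ball x ε).isPreconnected ?_ ?_ (Metric.mem_ball_self hε) (summable_smul ν (F₀ x))
    (Metric.mem_ball_self hε)
  · intro j y _
    exact (hF.hasFDerivAt y j).const_smul (ν j)
  · intro j y hy
    refine (norm_smul_le_bound ν (F₁ y) j).trans ?_
    exact mul_le_mul_of_nonneg_left (hB y hy) (abs_nonneg _)

/-- The Leibniz rule for the pairing of an `ℓ¹`-valued map, differentiable in norm, with a bounded
family which is differentiable entrywise. -/
theorem hasFDerivAt_pairing (hF : IsFamilyDeriv F₀ F₁) {ρ : X → L1 S} {ρ' : X →L[ℝ] L1 S} {x : X}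
    (hρ : HasFDerivAt ρ ρ' x) :
    HasFDerivAt (fun y => pairing S E (ρ y) (F₀ y))
      (((pairing S E).flip (F₀ x)).comp ρ' + pairing S (X →L[ℝ] E) (ρ x) (F₁ x)) x := by
  have h1 := hF.hasFDerivAt_pairing_const (ρ x) x
  have h2 : HasFDerivAt (fun y => pairing S E (ρ y) (F₀ x))
      (((pairing S E).flip (F₀ x)).comp ρ') x :=
    ((pairing S E).flip (F₀ x)).hasFDerivAt.comp x hρ
  -- The mixed increment is `O(‖y - x‖)` times `o(1)`, so mere sup-norm continuity of `F₀` suffices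
  -- here.
  have h3 : HasFDerivAt (fun y => pairing S E (ρ y - ρ x) (F₀ y - F₀ x)) (0 : X →L[ℝ] E) x := by
    refine HasFDerivAt.of_isLittleO ?_
    have ho : (fun y => F₀ y - F₀ x) =o[𝓝 x] fun _ => (1 : ℝ) := by
      rw [Asymptotics.isLittleO_one_iff]
      have := (hF.continuous.tendsto x).sub_const (F₀ x)
      rwa [sub_self] at this
    have hb : (fun y => pairing S E (ρ y - ρ x) (F₀ y - F₀ x)) =O[𝓝 x]
        fun y => ‖ρ y - ρ x‖ * ‖F₀ y - F₀ x‖ :=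
      Asymptotics.IsBigO.of_bound 1 (Eventually.of_forall fun y => by
        rw [one_mul, Real.norm_of_nonneg (by positivity)]
        exact norm_pairing_le _ _)
    have hm := hρ.isBigO_sub.norm_norm.mul_isLittleO ho.norm_left
    simp only [sub_self, map_zero, zero_apply, sub_zero]
    refine (hb.trans_isLittleO hm).trans_isBigO ?_
    simpa using (Asymptotics.isBigO_refl (fun y => y - x) (𝓝 x)).norm_left
  have h := (h2.add h1).add h3
  rw [add_zero] at h
  have h4 := h.sub_const (pairing S E (ρ x) (F₀ x))
  refine h4.congr_of_eventuallyEq (Eventually.of_forall fun y => ?_)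
  simp only [Pi.add_apply, map_sub, _root_.sub_apply]
  abel

-- Meant for the top derivative, which is continuous entrywise but perhaps not in sup norm. With `ρ
-- x` frozen, dominated convergence applies; the error is at most `‖ρ y - ρ x‖ * B`.
omit [NormedSpace ℝ X] in
theorem _root_.RowMatrix.continuous_pairing {ρ : X → L1 S} {G : X → LInf S E} (hρ : Continuous ρ)
    (hG : ∀ j, Continuous fun x => G x j) (hb : ∀ x, ∃ B : ℝ, ∀ᶠ y in 𝓝 x, ‖G y‖ ≤ B) :
    Continuous fun x => pairing S E (ρ x) (G x) := by
  refine continuous_iff_continuousAt.2 fun x => ?_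
  obtain ⟨B, hB⟩ := hb x
  have h1 : Tendsto (fun y => pairing S E (ρ x) (G y)) (𝓝 x) (𝓝 (pairing S E (ρ x) (G x))) := by
    refine tendsto_tsum_of_dominated_convergence (bound := fun j => |ρ x j| * B)
      ((hasSum_norm_L1 (ρ x)).summable.mul_right B)
      (fun j => ((hG j).tendsto x).const_smul (ρ x j)) ?_
    filter_upwards [hB] with y hy j
    exact (norm_smul_le_bound _ _ j).trans (mul_le_mul_of_nonneg_left hy (abs_nonneg _))
  have h2 : Tendsto (fun y => pairing S E (ρ y - ρ x) (G y)) (𝓝 x) (𝓝 0) := by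
    refine squeeze_zero_norm' (a := fun y => ‖ρ y - ρ x‖ * B) ?_ ?_
    · filter_upwards [hB] with y hy
      exact (norm_pairing_le _ _).trans (mul_le_mul_of_nonneg_left hy (norm_nonneg _))
    · have := ((hρ.tendsto x).sub_const (ρ x)).norm.mul_const B
      simpa using this
  have h := h1.add h2
  rw [add_zero] at h
  refine h.congr fun y => ?_
  simp

theorem contDiff_one_pairing (hF : IsFamilyDeriv F₀ F₁) (hF₁ : ∀ j, Continuous fun x => F₁ x j)
    {ρ : X → L1 S} (hρ : ContDiff ℝ 1 ρ) : ContDiff ℝ 1 fun x => pairing S E (ρ x) (F₀ x) := by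
  have hd : ∀ x, HasFDerivAt ρ (fderiv ℝ ρ x) x := fun x =>
    (hρ.differentiable one_ne_zero x).hasFDerivAt
  have h := fun x => hF.hasFDerivAt_pairing (hd x)
  refine contDiff_one_iff_fderiv.2 ⟨fun x => (h x).differentiableAt, ?_⟩
  rw [funext fun x => (h x).fderiv]
  refine Continuous.add ?_ (continuous_pairing hρ.continuous hF₁ hF.bounded)
  exact ((pairing S E).flip.continuous.comp hF.continuous).clm_comp
    (hρ.continuous_fderiv one_ne_zero)

theorem norm_fderiv_pairing_le (hF : IsFamilyDeriv F₀ F₁) {ρ : X → L1 S} {x : X}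
    (hρ : DifferentiableAt ℝ ρ x) :
    ‖fderiv ℝ (fun x => pairing S E (ρ x) (F₀ x)) x‖ ≤
      ‖fderiv ℝ ρ x‖ * ‖F₀ x‖ + ‖ρ x‖ * ‖F₁ x‖ := by
  rw [(hF.hasFDerivAt_pairing hρ.hasFDerivAt).fderiv]
  refine (norm_add_le _ _).trans (add_le_add ?_ (norm_pairing_le _ _))
  refine ContinuousLinearMap.opNorm_le_bound _ (by positivity) fun v => ?_
  refine (norm_pairing_le (fderiv ℝ ρ x v) (F₀ x)).trans ?_
  rw [mul_right_comm]
  exact mul_le_mul_of_nonneg_right ((fderiv ℝ ρ x).le_opNorm v) (norm_nonneg _)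

theorem fderiv_pairing_apply (hF : IsFamilyDeriv F₀ F₁) {ρ : X → L1 S} {x : X}
    (hρ : DifferentiableAt ℝ ρ x) (v : X) :
    fderiv ℝ (fun x => pairing S E (ρ x) (F₀ x)) x v =
      pairing S E (fderiv ℝ ρ x v) (F₀ x) + pairing S (X →L[ℝ] E) (ρ x) (F₁ x) v := by
  rw [(hF.hasFDerivAt_pairing hρ.hasFDerivAt).fderiv]
  rfl

theorem contDiff_two_pairing [FiniteDimensional ℝ X] (hF : IsFamilyDeriv F₀ F₁)
    (hF' : IsFamilyDeriv F₁ F₂) (hF₂ : ∀ j, Continuous fun x => F₂ x j)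
    {ρ : X → L1 S} (hρ : ContDiff ℝ 2 ρ) : ContDiff ℝ 2 fun x => pairing S E (ρ x) (F₀ x) := by
  have hρ1 : ContDiff ℝ 1 ρ := hρ.of_le one_le_two
  have hρ' : ContDiff ℝ 1 (fderiv ℝ ρ) := hρ.fderiv_right (by norm_num [one_add_one_eq_two])
  have hF₁ : ∀ j, Continuous fun x => F₁ x j := fun j =>
    continuous_iff_continuousAt.2 fun x => (hF'.hasFDerivAt x j).continuousAt
  have hd : ∀ x, DifferentiableAt ℝ ρ x := hρ1.differentiable one_ne_zero
  -- In finite dimension it suffices to treat directional derivatives, and each of these is a sum of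
  -- two terms covered by the first-order result.
  rw [← one_add_one_eq_two, contDiff_succ_iff_fderiv_apply]
  refine ⟨(hF.contDiff_one_pairing hF₁ hρ1).differentiable one_ne_zero, by simp, fun v => ?_⟩
  simp only [hF.fderiv_pairing_apply (hd _)]
  refine ContDiff.add ?_ ?_
  · exact hF.contDiff_one_pairing hF₁ (hρ'.clm_apply contDiff_const)
  · exact (hF'.contDiff_one_pairing hF₂ hρ1).clm_apply contDiff_const

theorem norm_iteratedFDeriv_two_pairing_le [FiniteDimensional ℝ X] (hF : IsFamilyDeriv F₀ F₁)
    (hF' : IsFamilyDeriv F₁ F₂) (hF₂ : ∀ j, Continuous fun x => F₂ x j)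
    {ρ : X → L1 S} (hρ : ContDiff ℝ 2 ρ) (x : X) :
    ‖iteratedFDeriv ℝ 2 (fun x => pairing S E (ρ x) (F₀ x)) x‖ ≤
      ‖iteratedFDeriv ℝ 2 ρ x‖ * ‖F₀ x‖ + 2 * (‖fderiv ℝ ρ x‖ * ‖F₁ x‖) + ‖ρ x‖ * ‖F₂ x‖ := by
  have hρ' : ContDiff ℝ 1 (fderiv ℝ ρ) := hρ.fderiv_right (by norm_num [one_add_one_eq_two])
  have hd : ∀ x, DifferentiableAt ℝ ρ x := hρ.differentiable two_ne_zero
  have hd' := hρ'.differentiable one_ne_zero x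
  have hΦ : ContDiff ℝ 1 (fderiv ℝ fun x => pairing S E (ρ x) (F₀ x)) :=
    (hF.contDiff_two_pairing hF' hF₂ hρ).fderiv_right (by norm_num [one_add_one_eq_two])
  rw [← norm_iteratedFDeriv_fderiv, ← norm_iteratedFDeriv_fderiv (f := ρ), norm_iteratedFDeriv_one,
    norm_iteratedFDeriv_one]
  set N := ‖fderiv ℝ (fderiv ℝ ρ) x‖
  refine ContinuousLinearMap.opNorm_le_bound₂ _ (by positivity) fun w v => ?_
  have hv : HasFDerivAt (fun y => fderiv ℝ ρ y v)
      ((fderiv ℝ (fderiv ℝ ρ) x).flip v) x := by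
    have := hd'.hasFDerivAt.clm_apply (hasFDerivAt_const v x)
    simpa using this
  have h1 := hF.hasFDerivAt_pairing hv
  have h2 := (hF'.hasFDerivAt_pairing (hd x).hasFDerivAt).clm_apply (hasFDerivAt_const v x)
  have h3 := (hΦ.differentiable one_ne_zero x).hasFDerivAt.clm_apply (hasFDerivAt_const v x)
  simp only [hF.fderiv_pairing_apply (hd _)] at h3
  have h4 := DFunLike.congr_fun (h3.unique (h1.add h2)) w
  simp only [_root_.add_apply, ContinuousLinearMap.comp_apply, ContinuousLinearMap.flip_apply,
    ContinuousLinearMap.comp_zero, zero_add] at h4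
  rw [h4]
  have b1 : ‖pairing S E (fderiv ℝ (fderiv ℝ ρ) x w v) (F₀ x)‖ ≤ N * ‖w‖ * ‖v‖ * ‖F₀ x‖ :=
    (norm_pairing_le _ _).trans
      (mul_le_mul_of_nonneg_right (ContinuousLinearMap.le_opNorm₂ _ _ _) (norm_nonneg _))
  have b2 : ‖pairing S (X →L[ℝ] E) (fderiv ℝ ρ x v) (F₁ x) w‖ ≤
      ‖fderiv ℝ ρ x‖ * ‖v‖ * ‖F₁ x‖ * ‖w‖ :=
    ContinuousLinearMap.le_of_opNorm_le _ ((norm_pairing_le _ _).trans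
      (mul_le_mul_of_nonneg_right (ContinuousLinearMap.le_opNorm _ _) (norm_nonneg _))) w
  have b3 : ‖pairing S (X →L[ℝ] E) (fderiv ℝ ρ x w) (F₁ x) v‖ ≤
      ‖fderiv ℝ ρ x‖ * ‖w‖ * ‖F₁ x‖ * ‖v‖ :=
    ContinuousLinearMap.le_of_opNorm_le _ ((norm_pairing_le _ _).trans
      (mul_le_mul_of_nonneg_right (ContinuousLinearMap.le_opNorm _ _) (norm_nonneg _))) v
  have b4 : ‖pairing S (X →L[ℝ] X →L[ℝ] E) (ρ x) (F₂ x) w v‖ ≤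
      ‖ρ x‖ * ‖F₂ x‖ * ‖w‖ * ‖v‖ :=
    ContinuousLinearMap.le_of_opNorm₂_le_of_le _ (norm_pairing_le _ _) le_rfl le_rfl
  refine (norm_add_le _ _).trans ((add_le_add (norm_add_le _ _) (norm_add_le _ _)).trans ?_)
  linarith

end IsFamilyDeriv

end BoundedFamilies

/-! ### Derivatives of inverses. -/

section Resolvent

variable {X : Type*} [NormedAddCommGroup X] [NormedSpace ℝ X]

theorem norm_iteratedFDeriv_const_add_clm_le {V W : Type*} [NormedAddCommGroup V] [NormedSpace ℝ V]
    [NormedAddCommGroup W] [NormedSpace ℝ W] (c : W) (L : V →L[ℝ] W) {f : X → V} {n : ℕ}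
    (hf : ContDiff ℝ (n + 1 : ℕ) f) (x : X) :
    ‖iteratedFDeriv ℝ (n + 1) (fun y => c + L (f y)) x‖ ≤ ‖L‖ * ‖iteratedFDeriv ℝ (n + 1) f x‖ := by
  rw [← norm_iteratedFDeriv_fderiv]
  have : (fderiv ℝ fun y => c + L (f y)) = fderiv ℝ (L ∘ f) := by
    ext1 y
    exact fderiv_const_add c
  rw [this, norm_iteratedFDeriv_fderiv]
  exact L.norm_iteratedFDeriv_comp_left hf.contDiffAt le_rfl

variable {A : Type*} [NormedRing A] [NormedAlgebra ℝ A] {T R : X → A}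

theorem contDiff_of_inverse [CompleteSpace A] (hTR : ∀ x, T x * R x = 1) (hRT : ∀ x, R x * T x = 1)
    {n : ℕ} (hT : ContDiff ℝ n T) : ContDiff ℝ n R := by
  have hR : R = fun x => Ring.inverse (T x) := funext fun x =>
    (Ring.inverse_unit (⟨T x, R x, hTR x, hRT x⟩ : Aˣ)).symm
  rw [hR]
  exact contDiff_iff_contDiffAt.2 fun x =>
    (contDiffAt_ringInverse ℝ (⟨T x, R x, hTR x, hRT x⟩ : Aˣ)).comp x hT.contDiffAt

/-- Use `R y = R x + R x (T x - T y) R y` with `x` frozen. The factor `R x (T x - T y)` vanishes at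
`y = x`, so in the Leibniz formula the top derivative of `R` drops out and a recursion on lower
orders remains. -/
theorem norm_iteratedFDeriv_inverse_le (hTR : ∀ x, T x * R x = 1) (hRT : ∀ x, R x * T x = 1)
    {n : ℕ} (hT : ContDiff ℝ (n + 1 : ℕ) T) (hR : ContDiff ℝ (n + 1 : ℕ) R) (x : X) :
    ‖iteratedFDeriv ℝ (n + 1) R x‖ ≤ ∑ i ∈ Finset.range (n + 1),
      ((n + 1).choose (i + 1) : ℝ) * (‖R x‖ * ‖iteratedFDeriv ℝ (i + 1) T x‖) *
        ‖iteratedFDeriv ℝ (n - i) R x‖ := by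
  set f : X → A := fun y => R x * T x + (-ContinuousLinearMap.mul ℝ A (R x)) (T y) with hf
  have hfC : ContDiff ℝ (n + 1 : ℕ) f :=
    contDiff_const.add ((-ContinuousLinearMap.mul ℝ A (R x)).contDiff.comp hT)
  have hR1 : R = fun y => R x + ContinuousLinearMap.id ℝ A (f y * R y) := by
    ext1 y
    have h1 : R x * T x * R y = R y := by rw [hRT, one_mul]
    have h2 : R x * T y * R y = R x := by rw [mul_assoc, hTR, mul_one]
    simp [f, add_mul, h1, h2]
  have h1 : ‖iteratedFDeriv ℝ (n + 1) R x‖ ≤ ‖iteratedFDeriv ℝ (n + 1) (fun y => f y * R y) x‖ := by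
    conv_lhs => rw [hR1]
    refine (norm_iteratedFDeriv_const_add_clm_le (R x) _ (hfC.mul hR) x).trans ?_
    exact mul_le_of_le_one_left (norm_nonneg _) ContinuousLinearMap.norm_id_le
  refine h1.trans ((norm_iteratedFDeriv_mul_le hfC hR x le_rfl).trans ?_)
  rw [Finset.sum_range_succ']
  have h0 : ‖iteratedFDeriv ℝ 0 f x‖ = 0 := by simp [f]
  rw [h0, mul_zero, zero_mul, add_zero]
  refine Finset.sum_le_sum fun i hi => ?_
  rw [Nat.add_sub_add_right]
  gcongr
  refine (norm_iteratedFDeriv_const_add_clm_le (n := i) _ _ (hT.of_le ?_) x).trans ?_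
  · exact_mod_cast Finset.mem_range.1 hi
  · gcongr
    rw [norm_neg]
    exact ContinuousLinearMap.opNorm_mul_apply_le ℝ A (R x)

end Resolvent

end

noncomputable section

open Set Filter MeasureTheory RowMatrix

/-! ### Bounds for the derivatives of the deviation operator. -/

section DeviationBounds

variable {X S : Type*} [NormedAddCommGroup X] [NormedSpace ℝ X] {Q : X → RowMatrix S}
  {R D : X → L1 S →L[ℝ] L1 S} {E : L1 S →L[ℝ] L1 S} {K : ℝ}

theorem contDiff_bordered {n : ℕ} (hQ : ContDiff ℝ n Q) : ContDiff ℝ n fun x => E - act S (Q x) :=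
  contDiff_const.sub ((act S).contDiff.comp hQ)

theorem norm_iteratedFDeriv_bordered_le {n : ℕ} (hQ : ContDiff ℝ (n + 1 : ℕ) Q) (x : X) :
    ‖iteratedFDeriv ℝ (n + 1) (fun x => E - act S (Q x)) x‖ ≤ ‖iteratedFDeriv ℝ (n + 1) Q x‖ := by
  have h := norm_iteratedFDeriv_const_add_clm_le E (-act S) hQ x
  simp only [neg_apply, ← sub_eq_add_neg, norm_neg] at h
  refine h.trans (mul_le_of_le_one_left (norm_nonneg _) ?_)
  exact ContinuousLinearMap.opNorm_le_bound _ zero_le_one fun M => by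
    rw [one_mul]
    exact norm_act_le M

theorem contDiff_deviation (hTR : ∀ x, (E - act S (Q x)) * R x = 1)
    (hRT : ∀ x, R x * (E - act S (Q x)) = 1) (hD : ∀ x, D x = R x * (1 - R x * E))
    {n : ℕ} (hQ : ContDiff ℝ n Q) : ContDiff ℝ n D := by
  have hR := contDiff_of_inverse hTR hRT (contDiff_bordered hQ)
  rw [funext hD]
  exact hR.mul (contDiff_const.sub (hR.mul contDiff_const))

theorem norm_iteratedFDeriv_one_sub_mul_le (hE : ‖E‖ ≤ 1) {n : ℕ} (hR : ContDiff ℝ (n + 1 : ℕ) R)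
    (x : X) : ‖iteratedFDeriv ℝ (n + 1) (fun x => 1 - R x * E) x‖ ≤
      ‖iteratedFDeriv ℝ (n + 1) R x‖ := by
  have h := norm_iteratedFDeriv_const_add_clm_le 1
    (-(ContinuousLinearMap.mul ℝ (L1 S →L[ℝ] L1 S)).flip E) hR x
  simp only [neg_apply, ← sub_eq_add_neg, norm_neg, ContinuousLinearMap.flip_apply,
    ContinuousLinearMap.mul_apply'] at h
  refine h.trans (mul_le_of_le_one_left (norm_nonneg _) ?_)
  refine ContinuousLinearMap.opNorm_le_bound _ zero_le_one fun B => ?_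
  rw [mul_comm]
  exact (norm_mul_le B E).trans (mul_le_mul_of_nonneg_left hE (norm_nonneg _))

theorem norm_one_sub_mul_le (hE : ‖E‖ ≤ 1) (hK : 1 ≤ K) {B : L1 S →L[ℝ] L1 S} (hB : ‖B‖ ≤ K) :
    ‖1 - B * E‖ ≤ 2 * K := by
  have h1 : ‖(1 : L1 S →L[ℝ] L1 S)‖ ≤ 1 := ContinuousLinearMap.norm_id_le
  have h2 : ‖B * E‖ ≤ K * 1 := (norm_mul_le B E).trans (by gcongr)
  linarith [norm_sub_le 1 (B * E)]

theorem norm_fderiv_resolvent_le (hTR : ∀ x, (E - act S (Q x)) * R x = 1)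
    (hRT : ∀ x, R x * (E - act S (Q x)) = 1) (hK : ∀ x, ‖R x‖ ≤ K)
    (hQ : ContDiff ℝ 1 Q) (x : X) :
    ‖iteratedFDeriv ℝ 1 R x‖ ≤ K ^ 2 * ‖iteratedFDeriv ℝ 1 Q x‖ := by
  have hQ' : ContDiff ℝ (0 + 1 : ℕ) Q := by simpa using hQ
  have hT := contDiff_bordered (E := E) hQ'
  have h := norm_iteratedFDeriv_inverse_le hTR hRT hT (contDiff_of_inverse hTR hRT hT) x
  have hq := norm_iteratedFDeriv_bordered_le (E := E) hQ' x
  simp only [zero_add, Finset.range_one, Finset.sum_singleton, Nat.choose_self, Nat.cast_one,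
    one_mul, Nat.sub_zero, norm_iteratedFDeriv_zero] at h hq
  refine h.trans ?_
  have hK0 : 0 ≤ K := (norm_nonneg _).trans (hK x)
  calc _ ≤ K * ‖iteratedFDeriv ℝ 1 Q x‖ * K := by gcongr <;> exact hK x
    _ = _ := by ring

theorem norm_iteratedFDeriv_two_resolvent_le (hTR : ∀ x, (E - act S (Q x)) * R x = 1)
    (hRT : ∀ x, R x * (E - act S (Q x)) = 1) (hK : ∀ x, ‖R x‖ ≤ K)
    (hQ : ContDiff ℝ 2 Q) (x : X) :
    ‖iteratedFDeriv ℝ 2 R x‖ ≤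
      2 * K ^ 3 * ‖iteratedFDeriv ℝ 1 Q x‖ ^ 2 + K ^ 2 * ‖iteratedFDeriv ℝ 2 Q x‖ := by
  have hQ2 : ContDiff ℝ (1 + 1 : ℕ) Q := by exact_mod_cast hQ
  have hQ1 : ContDiff ℝ (0 + 1 : ℕ) Q := hQ.of_le (by norm_num)
  have hT := contDiff_bordered (E := E) hQ2
  have h : ‖iteratedFDeriv ℝ 2 R x‖ ≤
      2 * (‖R x‖ * ‖iteratedFDeriv ℝ 1 (fun x => E - act S (Q x)) x‖) * ‖iteratedFDeriv ℝ 1 R x‖ +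
        ‖R x‖ * ‖iteratedFDeriv ℝ 2 (fun x => E - act S (Q x)) x‖ * ‖R x‖ :=
    (norm_iteratedFDeriv_inverse_le hTR hRT hT (contDiff_of_inverse hTR hRT hT) x).trans_eq
      (by simp [Finset.sum_range_succ])
  have hq1 : ‖iteratedFDeriv ℝ 1 (fun x => E - act S (Q x)) x‖ ≤ ‖iteratedFDeriv ℝ 1 Q x‖ :=
    norm_iteratedFDeriv_bordered_le hQ1 x
  have hq2 : ‖iteratedFDeriv ℝ 2 (fun x => E - act S (Q x)) x‖ ≤ ‖iteratedFDeriv ℝ 2 Q x‖ :=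
    norm_iteratedFDeriv_bordered_le hQ2 x
  have hR1 := norm_fderiv_resolvent_le hTR hRT hK (hQ.of_le one_le_two) x
  refine h.trans ?_
  have hK0 : 0 ≤ K := (norm_nonneg _).trans (hK x)
  calc _ ≤ 2 * (K * ‖iteratedFDeriv ℝ 1 Q x‖) * (K ^ 2 * ‖iteratedFDeriv ℝ 1 Q x‖) +
        K * ‖iteratedFDeriv ℝ 2 Q x‖ * K := by gcongr <;> exact hK x
    _ = _ := by ring

theorem norm_iteratedFDeriv_one_deviation_le (hTR : ∀ x, (E - act S (Q x)) * R x = 1)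
    (hRT : ∀ x, R x * (E - act S (Q x)) = 1) (hD : ∀ x, D x = R x * (1 - R x * E))
    (hE : ‖E‖ ≤ 1) (hK1 : 1 ≤ K) (hK : ∀ x, ‖R x‖ ≤ K) (hQ : ContDiff ℝ 1 Q) (x : X) :
    ‖iteratedFDeriv ℝ 1 D x‖ ≤ 3 * K ^ 3 * ‖iteratedFDeriv ℝ 1 Q x‖ := by
  have hQ' : ContDiff ℝ (0 + 1 : ℕ) Q := by simpa using hQ
  have hR := contDiff_of_inverse hTR hRT (contDiff_bordered hQ')
  have hR1 := norm_fderiv_resolvent_le hTR hRT hK hQ x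
  have hW1 : ‖iteratedFDeriv ℝ 1 (fun x => 1 - R x * E) x‖ ≤ ‖iteratedFDeriv ℝ 1 R x‖ :=
    norm_iteratedFDeriv_one_sub_mul_le hE hR x
  have hW0 := norm_one_sub_mul_le hE hK1 (hK x)
  have hW : ContDiff ℝ (0 + 1 : ℕ) fun x => 1 - R x * E := contDiff_const.sub (hR.mul contDiff_const)
  have h : ‖iteratedFDeriv ℝ 1 D x‖ ≤ ‖R x‖ * ‖iteratedFDeriv ℝ 1 (fun x => 1 - R x * E) x‖ +
      ‖iteratedFDeriv ℝ 1 R x‖ * ‖1 - R x * E‖ := by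
    rw [funext hD]
    exact (norm_iteratedFDeriv_mul_le hR hW x le_rfl).trans_eq (by simp [Finset.sum_range_succ])
  refine h.trans ?_
  set q := ‖iteratedFDeriv ℝ 1 Q x‖
  have hq : 0 ≤ q := norm_nonneg _
  calc _ ≤ K * (K ^ 2 * q) + K ^ 2 * q * (2 * K) := by
        gcongr
        · exact hK x
        · exact hW1.trans hR1
    _ = _ := by ring

theorem norm_iteratedFDeriv_two_deviation_le (hTR : ∀ x, (E - act S (Q x)) * R x = 1)
    (hRT : ∀ x, R x * (E - act S (Q x)) = 1) (hD : ∀ x, D x = R x * (1 - R x * E))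
    (hE : ‖E‖ ≤ 1) (hK1 : 1 ≤ K) (hK : ∀ x, ‖R x‖ ≤ K) (hQ : ContDiff ℝ 2 Q) (x : X) :
    ‖iteratedFDeriv ℝ 2 D x‖ ≤
      8 * K ^ 4 * ‖iteratedFDeriv ℝ 1 Q x‖ ^ 2 + 3 * K ^ 3 * ‖iteratedFDeriv ℝ 2 Q x‖ := by
  have hQ2 : ContDiff ℝ (1 + 1 : ℕ) Q := by exact_mod_cast hQ
  have hR := contDiff_of_inverse hTR hRT (contDiff_bordered hQ2)
  have hR' : ContDiff ℝ (0 + 1 : ℕ) R := hR.of_le (by norm_num)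
  have hR1 := norm_fderiv_resolvent_le hTR hRT hK (hQ.of_le one_le_two) x
  have hR2 := norm_iteratedFDeriv_two_resolvent_le hTR hRT hK hQ x
  have hW1 : ‖iteratedFDeriv ℝ 1 (fun x => 1 - R x * E) x‖ ≤ ‖iteratedFDeriv ℝ 1 R x‖ :=
    norm_iteratedFDeriv_one_sub_mul_le hE hR' x
  have hW2 : ‖iteratedFDeriv ℝ 2 (fun x => 1 - R x * E) x‖ ≤ ‖iteratedFDeriv ℝ 2 R x‖ :=
    norm_iteratedFDeriv_one_sub_mul_le hE hR x
  have hW0 := norm_one_sub_mul_le hE hK1 (hK x)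
  have hW : ContDiff ℝ (1 + 1 : ℕ) fun x => 1 - R x * E := contDiff_const.sub (hR.mul contDiff_const)
  have h : ‖iteratedFDeriv ℝ 2 D x‖ ≤ ‖R x‖ * ‖iteratedFDeriv ℝ 2 (fun x => 1 - R x * E) x‖ +
      2 * ‖iteratedFDeriv ℝ 1 R x‖ * ‖iteratedFDeriv ℝ 1 (fun x => 1 - R x * E) x‖ +
      ‖iteratedFDeriv ℝ 2 R x‖ * ‖1 - R x * E‖ := by
    rw [funext hD]
    exact (norm_iteratedFDeriv_mul_le hR hW x le_rfl).trans_eq (by simp [Finset.sum_range_succ])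
  refine h.trans ?_
  set q := ‖iteratedFDeriv ℝ 1 Q x‖
  set q' := ‖iteratedFDeriv ℝ 2 Q x‖
  have hq : 0 ≤ q := norm_nonneg _
  have hq' : 0 ≤ q' := norm_nonneg _
  -- The three Leibniz terms contribute `2 + 2 + 4` to the coefficient of `K ^ 4 * q ^ 2` and `1 + 0
  -- + 2` to that of `K ^ 3 * q'`.
  calc _ ≤ K * (2 * K ^ 3 * q ^ 2 + K ^ 2 * q') + 2 * (K ^ 2 * q) * (K ^ 2 * q) +
        (2 * K ^ 3 * q ^ 2 + K ^ 2 * q') * (2 * K) := by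
        gcongr
        · exact hK x
        · exact hW2.trans hR2
        · exact hW1.trans hR1
    _ = _ := by ring

end DeviationBounds

/-! ### Expectations along the chain. -/

namespace IsMarkovChain

variable {Ω S : Type*} [MeasurableSpace Ω] [MeasurableSpace S] {P : Measure Ω}
  {p : ℝ → S → S → ℝ} {i : S} {α : ℝ → Ω → S}

theorem measure_eq (h : IsMarkovChain P p i α) [MeasurableSingletonClass S] {t : ℝ} (ht : 0 ≤ t)
    (j : S) : P {ω | α t ω = j} = ENNReal.ofReal (p t i j) := by
  have := h.prob
  have h0 : ∀ᵐ ω ∂P, α 0 ω = i := by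
    have h1 := h.finiteDim 0 (fun _ => 0) (fun _ => i) monotone_const rfl rfl
    simp only [nonpos_iff_eq_zero, forall_eq, Finset.range_zero, Finset.prod_empty,
      ENNReal.ofReal_one] at h1
    exact (prob_compl_eq_zero_iff
      (h.measurable 0 le_rfl (measurableSet_singleton i))).2 h1
  -- The times are `0, t, t, …`, constant after index `1` to stay monotone. The extra condition `α 0
  -- = i` holds almost surely by `h0`.
  have h2 := h.finiteDim 1 (fun k => if k = 0 then 0 else t) (fun k => if k = 0 then i else j)
    (by
      intro k l hkl
      by_cases hk : k = 0 <;> by_cases hl : l = 0 <;> simp [hk, hl, ht]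
      omega)
    (if_pos rfl) (if_pos rfl)
  simp only [Finset.range_one, Finset.prod_singleton, zero_add, one_ne_zero, if_false, if_true,
    sub_zero] at h2
  rw [← h2]
  refine measure_congr ?_
  filter_upwards [h0] with ω hω
  refine propext ⟨fun (hj : α t ω = j) k hk => ?_, fun hj => show α t ω = j from ?_⟩
  · rcases Nat.le_one_iff_eq_zero_or_eq_one.1 hk with rfl | rfl
    · simpa using hω
    · simpa using hj
  · simpa using hj 1 le_rfl

variable {E : Type*} [NormedAddCommGroup E] [MeasurableSingletonClass S] [Countable S]

theorem integrable_comp (h : IsMarkovChain P p i α) {t : ℝ} (ht : 0 ≤ t) (f : LInf S E) :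
    Integrable (fun ω => f (α t ω)) P := by
  have := h.prob
  refine Integrable.of_bound (C := ‖f‖) ?_ (Eventually.of_forall fun ω => norm_apply_le f _)
  exact (StronglyMeasurable.of_discrete (f := fun j => f j)).comp_measurable
    (h.measurable t ht) |>.aestronglyMeasurable

variable [NormedSpace ℝ E] [CompleteSpace E]

theorem integral_comp (h : IsMarkovChain P p i α) {Q : RowMatrix S} (hp : IsTransitionFunction Q p)
    {t : ℝ} (ht : 0 ≤ t) (f : LInf S E) :
    ∫ ω, f (α t ω) ∂P = pairing S E (transOp p t (unitMass i)) f := by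
  have hm := h.measurable t ht
  have hsm : AEStronglyMeasurable (fun j => f j) (P.map (α t)) :=
    StronglyMeasurable.of_discrete.aestronglyMeasurable
  have hint : Integrable (fun j => f j) (P.map (α t)) :=
    (integrable_map_measure hsm hm.aemeasurable).2 (h.integrable_comp ht f)
  rw [← integral_map hm.aemeasurable hsm, integral_countable hint, pairing_apply]
  refine tsum_congr fun j => ?_
  rw [hp.transOp_unitMass_apply ht, Measure.real, Measure.map_apply hm (measurableSet_singleton j)]
  congr 1
  rw [show α t ⁻¹' {j} = {ω | α t ω = j} from rfl, h.measure_eq ht,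
    ENNReal.toReal_ofReal (hp.nonneg t ht i j)]

end IsMarkovChain

/-! ### Pointwise bounded families as maps into `ℓ^∞`. -/

section Families

theorem bddAbove_of_locally_bounded {X S : Type*} [TopologicalSpace X] {f : X → S → ℝ}
    (hb : ∀ x, ∃ B : ℝ, ∀ᶠ y in 𝓝 x, ∀ i, f y i ≤ B) (x : X) : BddAbove (range fun i => f x i) := by
  obtain ⟨B, hB⟩ := hb x
  exact ⟨B, by rintro _ ⟨i, rfl⟩; exact hB.self_of_nhds i⟩

variable {X S E : Type*} [NormedAddCommGroup E]

/-- A pointwise bounded family as a map to `ℓ^∞(S, E)`. -/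
def toLInf (F : X → S → E) (hF : ∀ x, BddAbove (range fun i => ‖F x i‖)) (x : X) : LInf S E :=
  ⟨F x, memℓp_infty (hF x)⟩

theorem norm_toLInf (F : X → S → E) (hF : ∀ x, BddAbove (range fun i => ‖F x i‖)) (x : X) :
    ‖toLInf F hF x‖ = supNorm (F x) := rfl

variable [NormedAddCommGroup X] [NormedSpace ℝ X] [NormedSpace ℝ E] {F : X → S → E}

theorem isFamilyDeriv_toLInf (hF : ∀ x, BddAbove (range fun i => ‖F x i‖))
    (hF' : ∀ x, BddAbove (range fun i => ‖fderiv ℝ (fun z => F z i) x‖))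
    (hd : ∀ i, Differentiable ℝ fun x => F x i)
    (hb : ∀ x, ∃ B : ℝ, ∀ᶠ y in 𝓝 x, ∀ i, ‖fderiv ℝ (fun z => F z i) y‖ ≤ B) :
    IsFamilyDeriv (toLInf F hF) (toLInf (fun x i => fderiv ℝ (fun z => F z i) x) hF') where
  hasFDerivAt x j := (hd j x).hasFDerivAt
  bounded x := by
    obtain ⟨B, hB⟩ := hb x
    -- For empty `S` the bound `B` may be negative.
    refine ⟨max B 0, hB.mono fun y hy => ?_⟩
    exact lp.norm_le_of_forall_le (le_max_right _ _) fun i => (hy i).trans (le_max_left _ _)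

theorem IsCkFamily.locally_bounded_fderiv {k : ℕ} (h : IsCkFamily k F) (hk : 1 ≤ k) (x : X) :
    ∃ B : ℝ, ∀ᶠ y in 𝓝 x, ∀ i, ‖fderiv ℝ (fun z => F z i) y‖ ≤ B := by
  simpa only [norm_iteratedFDeriv_one] using h.locally_bounded 1 hk x

theorem IsCkFamily.locally_bounded_fderiv_fderiv {k : ℕ} (h : IsCkFamily k F) (hk : 2 ≤ k) (x : X) :
    ∃ B : ℝ, ∀ᶠ y in 𝓝 x, ∀ i, ‖fderiv ℝ (fderiv ℝ fun z => F z i) y‖ ≤ B := by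
  have h2 : ∀ y i, ‖iteratedFDeriv ℝ 2 (fun z => F z i) y‖ =
      ‖fderiv ℝ (fderiv ℝ fun z => F z i) y‖ := fun y i => by
    rw [← norm_iteratedFDeriv_fderiv, norm_iteratedFDeriv_one]
  simpa only [h2] using h.locally_bounded 2 hk x

end Families

end

noncomputable section

open Set Filter MeasureTheory RowMatrix

/-! ### `Φ` as a row of the deviation operator paired with `F`. -/

section PoissonEquation

variable {S E : Type*} [NormedAddCommGroup E] [NormedSpace ℝ E] [CompleteSpace E]

/-- Evaluation of an operator on `ℓ¹(S)` at the unit mass at `i`, paired with the bounded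
family `f`. -/
def rowPairing (i : S) (f : LInf S E) : (L1 S →L[ℝ] L1 S) →L[ℝ] E :=
  ((pairing S E).flip f).comp (ContinuousLinearMap.apply ℝ (L1 S) (unitMass i))

theorem rowPairing_apply (i : S) (f : LInf S E) (B : L1 S →L[ℝ] L1 S) :
    rowPairing i f B = pairing S E (B (unitMass i)) f := rfl

theorem rowPairing_massSmul (i : S) (f : LInf S E) (v : L1 S) :
    rowPairing i f (massSmul v) = pairing S E v f := by
  rw [rowPairing_apply, massSmul_apply, mass_unitMass, one_smul]

theorem norm_rowPairing_le (i : S) (f : LInf S E) (B : L1 S →L[ℝ] L1 S) :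
    ‖rowPairing i f B‖ ≤ ‖B‖ * ‖f‖ := by
  refine (norm_pairing_le _ f).trans (mul_le_mul_of_nonneg_right ?_ (norm_nonneg _))
  simpa [norm_unitMass] using B.le_opNorm (unitMass i)

/-- Operators act on row vectors, so the composition `D * act S Q` is the matrix product of `Q`
followed by `D`. Hence the Poisson equation uses the identity for `D * act S Q`. -/
theorem hasSum_entry_smul_rowPairing (Q : RowMatrix S) (D : L1 S →L[ℝ] L1 S) (f : LInf S E)
    (i : S) : HasSum (fun j => Q.entry i j • rowPairing j f D) (rowPairing i f (D * act S Q)) := by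
  have h := hasSum_clm (((pairing S E).flip f).comp D) (act S Q (unitMass i))
  rw [act_unitMass] at h
  rw [rowPairing_apply,
    show (D * act S Q) (unitMass i) = D (Q i) from congrArg D (act_unitMass Q i)]
  exact h

variable {Ω : Type*} [MeasurableSpace S] [MeasurableSingletonClass S] [Countable S]
  [MeasurableSpace Ω] {P : Measure Ω} {α : ℝ → Ω → S} {Q : RowMatrix S} {p : ℝ → S → S → ℝ} {i : S}
  {μ : S → ℝ}

theorem IsMarkovChain.integral_comp_eq_rowPairing (h : IsMarkovChain P p i α)
    (hp : IsTransitionFunction Q p) (hμ : SolvesInvariance Q μ) {f : LInf S E}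
    (hf : pairing S E hμ.law f = 0) {t : ℝ} (ht : 0 ≤ t) :
    ∫ ω, f (α t ω) ∂P = rowPairing i f (transOp p t - massSmul hμ.law) := by
  rw [h.integral_comp hp ht, map_sub, rowPairing_massSmul, hf, sub_zero, rowPairing_apply]

theorem IsMarkovChain.integrableOn_integral_comp (h : IsMarkovChain P p i α)
    (hp : IsTransitionFunction Q p) (hμ : SolvesInvariance Q μ) {f : LInf S E}
    (hf : pairing S E hμ.law f = 0)
    (hint : IntegrableOn (fun t => transOp p t - massSmul hμ.law) (Ioi 0)) :
    IntegrableOn (fun t => ∫ ω, f (α t ω) ∂P) (Ioi 0) :=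
  IntegrableOn.congr_fun ((rowPairing i f).integrable_comp hint)
    (fun _ ht => (h.integral_comp_eq_rowPairing hp hμ hf (le_of_lt ht)).symm) measurableSet_Ioi

theorem IsMarkovChain.integral_integral_comp (h : IsMarkovChain P p i α)
    (hp : IsTransitionFunction Q p) (hμ : SolvesInvariance Q μ) {f : LInf S E}
    (hf : pairing S E hμ.law f = 0)
    (hint : IntegrableOn (fun t => transOp p t - massSmul hμ.law) (Ioi 0)) :
    ∫ t in Ioi (0 : ℝ), ∫ ω, f (α t ω) ∂P =
      rowPairing i f (IsContractionSemigroup.deviation (transOp p) (massSmul hμ.law)) := by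
  rw [setIntegral_congr_fun measurableSet_Ioi
    fun t ht => h.integral_comp_eq_rowPairing hp hμ hf (le_of_lt ht)]
  exact (rowPairing i f).integral_comp_comm hint

end PoissonEquation

/-! ### Smoothness of the paired rows. -/

section Regularity

variable {X S E : Type*} [NormedAddCommGroup X] [NormedSpace ℝ X]
  [NormedAddCommGroup E] [NormedSpace ℝ E] {F : X → S → E}
  {D : X → L1 S →L[ℝ] L1 S} {k : ℕ}

theorem norm_iteratedFDeriv_apply_unitMass_le (hD : ContDiff ℝ k D) (i : S) (x : X) :
    ‖iteratedFDeriv ℝ k (fun x => D x (unitMass i)) x‖ ≤ ‖iteratedFDeriv ℝ k D x‖ := by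
  have h := norm_iteratedFDeriv_clm_apply_const (c := unitMass i) (x := x) hD.contDiffAt le_rfl
  rwa [norm_unitMass, one_mul] at h

variable [CompleteSpace E]

theorem IsCkFamily.contDiff_one_rowPairing (hF : IsCkFamily 1 F)
    (hb : ∀ x, BddAbove (range fun i => ‖F x i‖)) (hD : ContDiff ℝ 1 D) (i : S) :
    ContDiff ℝ 1 (fun x => rowPairing i (toLInf F hb x) (D x)) ∧
      ∀ x, ‖fderiv ℝ (fun x => rowPairing i (toLInf F hb x) (D x)) x‖ ≤
        ‖iteratedFDeriv ℝ 1 D x‖ * supNorm (F x) +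
          ‖D x‖ * supNorm (fun j => fderiv ℝ (fun z => F z j) x) := by
  have hb' := hF.locally_bounded_fderiv le_rfl
  have hF1 := isFamilyDeriv_toLInf hb (bddAbove_of_locally_bounded hb')
    (fun j => (hF.contDiff j).differentiable (by simp)) hb'
  have hρ : ContDiff ℝ 1 fun x => D x (unitMass i) := hD.clm_apply contDiff_const
  refine ⟨hF1.contDiff_one_pairing (fun j => (hF.contDiff j).continuous_fderiv (by simp)) hρ,
    fun x => (hF1.norm_fderiv_pairing_le (hρ.differentiable one_ne_zero x)).trans ?_⟩
  rw [norm_toLInf, norm_toLInf, ← norm_iteratedFDeriv_one]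
  have h0 := norm_iteratedFDeriv_apply_unitMass_le (k := 0) (hD.of_le (by simp)) i x
  have h1 := norm_iteratedFDeriv_apply_unitMass_le (k := 1) hD i x
  rw [norm_iteratedFDeriv_zero, norm_iteratedFDeriv_zero] at h0
  have s0 : 0 ≤ supNorm (F x) := Real.iSup_nonneg fun _ => norm_nonneg _
  have s1 : 0 ≤ supNorm (fun j => fderiv ℝ (fun z => F z j) x) :=
    Real.iSup_nonneg fun _ => norm_nonneg _
  gcongr

variable [FiniteDimensional ℝ X]

theorem IsCkFamily.contDiff_two_rowPairing (hF : IsCkFamily 2 F)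
    (hb : ∀ x, BddAbove (range fun i => ‖F x i‖)) (hD : ContDiff ℝ 2 D) (i : S) :
    ContDiff ℝ 2 (fun x => rowPairing i (toLInf F hb x) (D x)) ∧
      ∀ x, ‖iteratedFDeriv ℝ 2 (fun x => rowPairing i (toLInf F hb x) (D x)) x‖ ≤
        ‖iteratedFDeriv ℝ 2 D x‖ * supNorm (F x) +
          2 * (‖iteratedFDeriv ℝ 1 D x‖ * supNorm (fun j => fderiv ℝ (fun z => F z j) x)) +
          ‖D x‖ * supNorm (fun j => iteratedFDeriv ℝ 2 (fun z => F z j) x) := by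
  have hb' := hF.locally_bounded_fderiv one_le_two
  have hb'' := hF.locally_bounded_fderiv_fderiv le_rfl
  have hC : ∀ j, ContDiff ℝ 1 (fderiv ℝ fun x => F x j) := fun j =>
    (hF.contDiff j).fderiv_right (by norm_num [one_add_one_eq_two])
  have hF1 := isFamilyDeriv_toLInf hb (bddAbove_of_locally_bounded hb')
    (fun j => (hF.contDiff j).differentiable (by simp)) hb'
  have hF2 := isFamilyDeriv_toLInf (F := fun x j => fderiv ℝ (fun z => F z j) x)
    (bddAbove_of_locally_bounded hb') (bddAbove_of_locally_bounded hb'')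
    (fun j => (hC j).differentiable one_ne_zero) hb''
  have hc : ∀ j, Continuous fun x => fderiv ℝ (fderiv ℝ fun z => F z j) x := fun j =>
    (hC j).continuous_fderiv one_ne_zero
  have hρ : ContDiff ℝ 2 fun x => D x (unitMass i) := hD.clm_apply contDiff_const
  refine ⟨hF1.contDiff_two_pairing hF2 hc hρ,
    fun x => (hF1.norm_iteratedFDeriv_two_pairing_le hF2 hc hρ x).trans ?_⟩
  have hsup : supNorm (fun j => iteratedFDeriv ℝ 2 (fun z => F z j) x) =
      supNorm (fun j => fderiv ℝ (fderiv ℝ fun z => F z j) x) :=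
    iSup_congr fun j => by rw [← norm_iteratedFDeriv_fderiv, norm_iteratedFDeriv_one]
  rw [norm_toLInf, norm_toLInf, norm_toLInf, ← norm_iteratedFDeriv_one, hsup]
  have h0 := norm_iteratedFDeriv_apply_unitMass_le (k := 0) (hD.of_le (by simp)) i x
  have h1 := norm_iteratedFDeriv_apply_unitMass_le (k := 1) (hD.of_le (by simp)) i x
  have h2 := norm_iteratedFDeriv_apply_unitMass_le (k := 2) hD i x
  rw [norm_iteratedFDeriv_zero, norm_iteratedFDeriv_zero] at h0
  have s0 : 0 ≤ supNorm (F x) := Real.iSup_nonneg fun _ => norm_nonneg _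
  have s1 : 0 ≤ supNorm (fun j => fderiv ℝ (fun z => F z j) x) :=
    Real.iSup_nonneg fun _ => norm_nonneg _
  have s2 : 0 ≤ supNorm (fun j => fderiv ℝ (fderiv ℝ fun z => F z j) x) :=
    Real.iSup_nonneg fun j => norm_nonneg (fderiv ℝ (fderiv ℝ fun z => F z j) x)
  gcongr

end Regularity

end

/-! ### Assembly of the estimates. -/

theorem theorem2p1 {n : ℕ} {S Ω : Type*} [Countable S] [MeasurableSpace S]
    [MeasurableSingletonClass S] [MeasurableSpace Ω] (C₀ r : ℝ) (hC₀ : 0 < C₀) (hr : 0 < r) :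
    ∃ C : ℝ, 0 < C ∧
      ∀ (Q : EuclideanSpace ℝ (Fin n) → RowMatrix S)
        (μ : EuclideanSpace ℝ (Fin n) → S → ℝ)
        (p : EuclideanSpace ℝ (Fin n) → ℝ → S → S → ℝ)
        (F : EuclideanSpace ℝ (Fin n) → S → EuclideanSpace ℝ (Fin n))
        (P : EuclideanSpace ℝ (Fin n) → S → MeasureTheory.Measure Ω)
        (α : EuclideanSpace ℝ (Fin n) → S → ℝ → Ω → S),
        IsUniformlyErgodic Q μ p C₀ r →
        (∀ x, BddAbove (Set.range fun i => ‖F x i‖)) →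
        (∀ x, HasSum (fun i => μ x i • F x i) 0) →
        (∀ x i, IsMarkovChain (P x i) (p x) i (α x i)) →
        -- `Φ` is well defined, bounded, and solves the Poisson equation
        ((∀ x i,
            (∀ t, 0 ≤ t → MeasureTheory.Integrable (fun ω => F x (α x i t ω)) (P x i)) ∧
            MeasureTheory.IntegrableOn (fun t => ∫ ω, F x (α x i t ω) ∂(P x i)) (Set.Ioi 0) ∧
            HasSum (fun j => (Q x).entry i j • poissonSolution P α F x j) (-F x i) ∧
            ‖poissonSolution P α F x i‖ ≤ C * supNorm (F x)) ∧
        -- first order regularity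
        (ContDiff ℝ 1 Q → IsCkFamily 1 F →
          ∀ i, ContDiff ℝ 1 (fun x => poissonSolution P α F x i) ∧
            ∀ x, ‖fderiv ℝ (fun z => poissonSolution P α F z i) x‖ ≤
              C * (supNorm (F x) * ‖fderiv ℝ Q x‖ +
                supNorm (fun j => fderiv ℝ (fun z => F z j) x))) ∧
        -- second order regularity
        (ContDiff ℝ 2 Q → IsCkFamily 2 F →
          ∀ i, ContDiff ℝ 2 (fun x => poissonSolution P α F x i) ∧
            ∀ x, ‖iteratedFDeriv ℝ 2 (fun z => poissonSolution P α F z i) x‖ ≤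
              C * (supNorm (F x) *
                  (‖fderiv ℝ Q x‖ + ‖fderiv ℝ Q x‖ ^ 2 + ‖iteratedFDeriv ℝ 2 Q x‖) +
                supNorm (fun j => fderiv ℝ (fun z => F z j) x) * ‖fderiv ℝ Q x‖ +
                supNorm (fun j => iteratedFDeriv ℝ 2 (fun z => F z j) x)))) := by
  set K : ℝ := 2 * (C₀ / r) + 1 with hKdef
  have hC₀r : 0 < C₀ / r := div_pos hC₀ hr
  have hK1 : 1 ≤ K := by linarith
  have hK0 : 0 < K := by linarith
  have hK34 : K ^ 3 ≤ K ^ 4 := pow_le_pow_right₀ hK1 (by norm_num)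
  have hK14 : K ≤ K ^ 4 := le_self_pow₀ hK1 (by norm_num)
  refine ⟨8 * K ^ 4, by positivity, fun Q μ p F P α hQ hb hcent hα => ?_⟩
  have hμ := fun x => (hQ.irreducible x).solves
  set D : EuclideanSpace ℝ (Fin n) → RowMatrix.L1 S →L[ℝ] RowMatrix.L1 S := fun x =>
    IsContractionSemigroup.deviation (RowMatrix.transOp (p x)) (RowMatrix.massSmul (hμ x).law)
  -- The state carrying the border `E` is the one at which `Φ` is evaluated, so `S` need not be
  -- assumed nonempty; `E` still does not depend on `x`.
  have hdev := fun x (i : S) => deviation_eq hC₀ hr (hQ.conservative x) (hμ x)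
    (hQ.irreducible x).pos (hQ.transition x) (hQ.ergodic x) i
  have hlaw : ∀ x, RowMatrix.pairing S _ (hμ x).law (toLInf F hb x) = 0 := fun x =>
    (RowMatrix.hasSum_pairing (hμ x).law (toLInf F hb x)).unique (hcent x)
  have hΦ : ∀ x i, poissonSolution P α F x i = rowPairing i (toLInf F hb x) (D x) := fun x i =>
    (hα x i).integral_integral_comp (hQ.transition x) (hμ x) (hlaw x) (hdev x i).1
  have hΦ' : ∀ i, (fun x => poissonSolution P α F x i) =
      fun x => rowPairing i (toLInf F hb x) (D x) := fun i => funext fun x => hΦ x i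
  have hDK : ∀ x (_ : S), ‖D x‖ ≤ K := fun x i => (hdev x i).2.1.trans (by linarith)
  have hs0 : ∀ x, 0 ≤ supNorm (F x) := fun x => Real.iSup_nonneg fun _ => norm_nonneg _
  have hs1 : ∀ x, 0 ≤ supNorm (fun j => fderiv ℝ (fun z => F z j) x) := fun x =>
    Real.iSup_nonneg fun _ => norm_nonneg _
  have hs2 : ∀ x, 0 ≤ supNorm (fun j => iteratedFDeriv ℝ 2 (fun z => F z j) x) := fun x =>
    Real.iSup_nonneg fun _ => norm_nonneg _
  refine ⟨fun x i => ⟨fun t ht => (hα x i).integrable_comp ht (toLInf F hb x), ?_, ?_, ?_⟩,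
    fun hQ1 hF i => ?_, fun hQ2 hF i => ?_⟩
  · exact (hα x i).integrableOn_integral_comp (hQ.transition x) (hμ x) (hlaw x) (hdev x i).1
  · simp only [hΦ]
    have h := hasSum_entry_smul_rowPairing (Q x) (D x) (toLInf F hb x) i
    rw [(hdev x i).2.2.1, map_sub, rowPairing_massSmul, hlaw, zero_sub, rowPairing_apply,
      one_apply_eq_self, RowMatrix.pairing_unitMass] at h
    exact h
  · rw [hΦ]
    refine (norm_rowPairing_le i _ (D x)).trans ?_
    rw [norm_toLInf]
    refine mul_le_mul_of_nonneg_right ?_ (hs0 x)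
    linarith [hDK x i]
  · choose R hTR hRT hR hDR using fun x => (hdev x i).2.2.2
    have hE := (RowMatrix.norm_massSmul_le _).trans (RowMatrix.norm_unitMass i).le
    rw [hΦ']
    have hD := contDiff_deviation (n := 1) hTR hRT hDR hQ1
    obtain ⟨h1, h2⟩ := hF.contDiff_one_rowPairing hb hD i
    refine ⟨h1, fun x => (h2 x).trans ?_⟩
    have hD1 := norm_iteratedFDeriv_one_deviation_le hTR hRT hDR hE hK1 hR hQ1 x
    have hD0 := hDK x i
    rw [norm_iteratedFDeriv_one (f := Q)] at hD1
    have hs0 := hs0 x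
    have hs1 := hs1 x
    calc _ ≤ 3 * K ^ 3 * ‖fderiv ℝ Q x‖ * supNorm (F x) +
          K * supNorm (fun j => fderiv ℝ (fun z => F z j) x) := by gcongr
      _ ≤ 8 * K ^ 4 * ‖fderiv ℝ Q x‖ * supNorm (F x) +
          8 * K ^ 4 * supNorm (fun j => fderiv ℝ (fun z => F z j) x) := by
        gcongr
        · norm_num
        · linarith
      _ = _ := by ring
  · choose R hTR hRT hR hDR using fun x => (hdev x i).2.2.2
    have hE := (RowMatrix.norm_massSmul_le _).trans (RowMatrix.norm_unitMass i).le
    rw [hΦ']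
    have hD := contDiff_deviation (n := 2) hTR hRT hDR hQ2
    obtain ⟨h1, h2⟩ := hF.contDiff_two_rowPairing hb hD i
    refine ⟨h1, fun x => (h2 x).trans ?_⟩
    have hD1 := norm_iteratedFDeriv_one_deviation_le hTR hRT hDR hE hK1 hR
      (hQ2.of_le one_le_two) x
    have hD2 := norm_iteratedFDeriv_two_deviation_le hTR hRT hDR hE hK1 hR hQ2 x
    have hD0 := hDK x i
    rw [norm_iteratedFDeriv_one (f := Q)] at hD1 hD2
    have hs0 := hs0 x
    have hs1 := hs1 x
    have hs2 := hs2 x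
    set s₀ := supNorm (F x)
    set s₁ := supNorm (fun j => fderiv ℝ (fun z => F z j) x)
    set s₂ := supNorm (fun j => iteratedFDeriv ℝ 2 (fun z => F z j) x)
    set q₁ := ‖fderiv ℝ Q x‖
    set q₂ := ‖iteratedFDeriv ℝ 2 Q x‖
    have hq1 : 0 ≤ q₁ := norm_nonneg _
    have hq2 : 0 ≤ q₂ := norm_nonneg _
    calc _ ≤ (8 * K ^ 4 * q₁ ^ 2 + 3 * K ^ 3 * q₂) * s₀ + 2 * (3 * K ^ 3 * q₁ * s₁) + K * s₂ := by
          gcongr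
      _ ≤ (8 * K ^ 4 * q₁ ^ 2 + 8 * K ^ 4 * q₂) * s₀ + 8 * K ^ 4 * q₁ * s₁ + 8 * K ^ 4 * s₂ +
          8 * K ^ 4 * (s₀ * q₁) := by
        have e1 : 3 * K ^ 3 * q₂ ≤ 8 * K ^ 4 * q₂ := by gcongr; norm_num
        have e2 : 2 * (3 * K ^ 3 * q₁ * s₁) ≤ 8 * K ^ 4 * q₁ * s₁ := by
          calc 2 * (3 * K ^ 3 * q₁ * s₁) = 6 * K ^ 3 * q₁ * s₁ := by ring
            _ ≤ 8 * K ^ 4 * q₁ * s₁ := by gcongr; norm_num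
        have e3 : K * s₂ ≤ 8 * K ^ 4 * s₂ := by gcongr; linarith
        -- The bound obtained has no term `s₀ * q₁`; it is added only to match the stated form.
        have e4 : 0 ≤ 8 * K ^ 4 * (s₀ * q₁) := by positivity
        have e5 := mul_le_mul_of_nonneg_right (add_le_add_right e1 (8 * K ^ 4 * q₁ ^ 2)) hs0
        linarith
      _ = _ := by ring
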